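/- Let $\mathcal F$ be the complex Fock space of one pair of fermionic fields with modes $\psi^{+}_r,\psi^-_r$ ($r\in\frac12+\mathbb Z$), i.e. $[\psi^+_r,\psi^-_s]_+=\delta_{r+s,0}$, $[\psi^\pm_r,\psi^\pm_s]_+=0$, generated by a vacuum vector $|0\rangle$ with $\psi^\pm_r|0\rangle=0$ for $r>0$. Let $:\ :$ denote normal ordering, put $E_{ij}={:}\psi^+_{1/2-i}\psi^-_{j-1/2}{:}$ for $i,j\in\mathbb Z$, $$L_0=\sum_{k\in\frac12+\mathbb Z}k\,{:}\psi^+_{-k}\psi^-_{k}{:},\qquad \mathsf D(t)=\sum_{k\ge1}\bigl(t^{k-\frac12}-t^{\frac12-k}\bigr)\bigl(E_{k,k}-E_{1-k,1-k}\bigr)+\frac{2}{t^{\frac12}-t^{-\frac12}},$$ and let $\mathcal F^{(0)}$ be the kernel of the charge operator $\sum_{r}{:}\psi^+_r\psi^-_{-r}{:}$. The element $\tau=\begin{bmatrix}0&1\\1&0\end{bmatrix}\in O(2)$ acts on $\mathcal F$ by fixing $|0\rangle$ and exchanging $\psi^+_r$ and $\psi^-_r$ for every $r$; let $\mathcal F^{(0)}_\pm$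 be the $(\pm1)$-eigenspace of $\tau$ on $\mathcal F^{(0)}$. Write $(a;q)_\infty=\prod_{r\ge0}(1-aq^r)$ and $$\Theta(t)=(t^{\frac12}-t^{-\frac12})(q;q)_\infty^{-2}(qt;q)_\infty(qt^{-1};q)_\infty .$$ Let $q,t\in\mathbb C$ with $|q|<1$, $|q|<|t|$, $|q||t|<1$ and $t\ne1$, and fix any continuous branch of the square root near $t$. Then $\mathcal F^{(0)}_\pm$ is the direct sum of its $L_0$-eigenspaces with eigenvalues $n=0,1,2,\dots$; these are finite-dimensional and stable under $\mathsf D(t)$, and the trace $\mathrm{tr}_{\mathcal F^{(0)}_\pm}q^{L_0}\mathsf D(t)$ (the sum over $n$ of $q^n$ times the trace of $\mathsf D(t)$ on the $n$-th eigenspace) converges absolutely and equals $$\frac{1}{(q;q)_\infty\Theta(t)}\pm(q;q^2)_\infty\left(\sum_{r=0}^\infty\Bigl(\frac{q^{r+1}t^{-\frac12}}{1-q^{2(r+1)}t^{-1}}-\frac{q^{r+1}t^{\frac12}}{1-q^{2(r+1)}t}\Bigr)+\frac{1}{t^{\frac12}-t^{-\frac12}}\right),$$ the series being absolutely convergent.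 Equivalently, it equals $$\frac{1}{(q;q)_\infty\Theta(t)}\pm(q;q^2)_\infty\;t\frac{d}{dt}\ln\left(\frac{(t^{-\frac12};q)_\infty(qt^{\frac12};q)_\infty}{(-t^{-\frac12};q)_\infty(-qt^{\frac12};q)_\infty}\right),$$ where the ratio is differentiable and non-zero at $t$ and $\frac{d}{dt}\ln$ denotes its logarithmic derivative. -/

import Mathlib

open Filter Topology

noncomputable section

namespace FermionFock

/-- Creation modes: `(true, m)` stands for `ψ⁺_{-(m+1/2)}` and `(false, m)` for `ψ⁻_{-(m+1/2)}`,
where `m = 0, 1, 2, …`. -/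
abbrev Mode : Type := Bool × ℕ

/-- The Fock space of one pair of fermionic fields: the exterior algebra on the creation modes.
The vacuum vector is `1`. -/
abbrev Fock : Type := ExteriorAlgebra ℂ (Mode →₀ ℂ)

/-- Creation operator: left multiplication by the mode `a`. -/
def create (a : Mode) : Module.End ℂ Fock :=
  LinearMap.mulLeft ℂ (ExteriorAlgebra.ι ℂ (Finsupp.single a 1))

/-- Annihilation operator: contraction with the coordinate functional of the mode `a`. -/
def annihilate (a : Mode) : Module.End ℂ Fock :=
  CliffordAlgebra.contractLeft (Finsupp.lapply a : (Mode →₀ ℂ) →ₗ[ℂ] ℂ)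

/-- The fermionic modes: `psi true i = ψ⁺_{i+1/2}` and `psi false i = ψ⁻_{i+1/2}` for `i ∈ ℤ`.
For `i = -(m+1) < 0` this is the creation operator `ψ^±_{-(m+1/2)}`; for `i = m ≥ 0` it is the
annihilation operator `ψ^±_{m+1/2}`, which is dual to `ψ^∓_{-(m+1/2)}`. Thus
`[ψ⁺_r, ψ⁻_s]₊ = δ_{r+s,0}`, `[ψ^±_r, ψ^±_s]₊ = 0`, and `ψ^±_r` kills the vacuum for `r > 0`. -/
def psi (s : Bool) : ℤ → Module.End ℂ Fock
  | Int.ofNat m => annihilate (!s, m)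
  | Int.negSucc m => create (s, m)

/-- The normally ordered product `:ψ⁺_{i+1/2} ψ⁻_{j+1/2}:`, in which operators that annihilate
the vacuum are moved to the right with a sign. -/
def normalOrd (i j : ℤ) : Module.End ℂ Fock :=
  if 0 ≤ i then -(psi false j * psi true i) else psi true i * psi false j

/-- The sum of a family of operators, only finitely many of which are non-zero on any vector. -/
def opSum {ι : Type*} (A : ι → Module.End ℂ Fock)
    (hA : ∀ v, (Function.support fun i => A i v).Finite) : Module.End ℂ Fock where
  toFun v := ∑ᶠ i, A i v
  map_add' v w := by
    simp only [map_add]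
    exact finsum_add_distrib (hA v) (hA w)
  map_smul' c v := by
    simp only [map_smul, RingHom.id_apply]
    exact (smul_finsum' c (hA v)).symm

theorem annihilate_finite (v : Fock) :
    (Function.support fun a : Mode => annihilate a v).Finite := by
  induction v using CliffordAlgebra.left_induction with
  | algebraMap r => simp [annihilate, Function.support]
  | add x y hx hy =>
    simp only [map_add]
    exact (hx.union hy).subset (Function.support_add _ _)
  | ι_mul x m hx =>
    refine (m.support.finite_toSet.union hx).subset fun a ha => ?_
    by_contra hn
    simp only [Set.mem_union, Function.mem_support, not_or, not_not, Finset.mem_coe,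
      Finsupp.mem_support_iff] at hn
    refine ha ?_
    have h2 := hn.2
    simp only [annihilate] at h2 ⊢
    rw [CliffordAlgebra.contractLeft_ι_mul, h2]
    simp [hn.1]

theorem normalOrd_finite (v : Fock) :
    (Function.support fun i : ℤ => normalOrd i (-i - 1) v).Finite := by
  have hf : Function.Injective (fun a : Mode => if a.1 then Int.negSucc a.2 else (a.2 : ℤ)) := by
    rintro ⟨_ | _, m⟩ ⟨_ | _, n⟩ h <;> simp at h ⊢ <;> omega
  refine ((annihilate_finite v).image
    (fun a : Mode => if a.1 then Int.negSucc a.2 else (a.2 : ℤ))).subset fun i hi => ?_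
  rcases i with m | m
  · refine ⟨(false, m), fun h => hi ?_, by simp⟩
    simp only at h
    simp [normalOrd, psi, h]
  · refine ⟨(true, m), fun h => hi ?_, by simp⟩
    simp only at h
    have e : -Int.negSucc m - 1 = Int.ofNat m := by
      rw [Int.negSucc_eq]; simp
    simp only [normalOrd, e]
    rw [if_neg (by simp)]
    simp [psi, h]

/-- The charge operator `∑_{r ∈ ℤ+1/2} :ψ⁺_r ψ⁻_{-r}:` (here `r = i + 1/2`). -/
def charge : Module.End ℂ Fock :=
  opSum (fun i : ℤ => normalOrd i (-i - 1)) normalOrd_finite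

/-- The energy operator `L₀ = ∑_{k ∈ ℤ+1/2} k :ψ⁺_{-k} ψ⁻_k:` (here `-k = i + 1/2`). -/
def energy : Module.End ℂ Fock :=
  opSum (fun i : ℤ => (-((i : ℂ) + 1 / 2)) • normalOrd i (-i - 1)) fun v =>
    (normalOrd_finite v).subset fun i hi h => hi (by
      simp only at h
      simp [h])

/-- The operator `E_{ij} = :ψ⁺_{1/2-i} ψ⁻_{j-1/2}:`, the coefficient of `z^{i-1} w^{-j}` in
`:ψ⁺(z) ψ⁻(w):`. -/
def E (i j : ℤ) : Module.End ℂ Fock := normalOrd (-i) (j - 1)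

theorem E_finite (v : Fock) : (Function.support fun i : ℤ => E i i v).Finite := by
  refine ((normalOrd_finite v).image fun i => -i).subset fun i hi => ⟨-i, fun h => hi ?_, by simp⟩
  simpa [E] using h

/-- `:D(t): = ∑_{k ≥ 1} (t^{k-1/2} - t^{1/2-k}) (E_{k,k} - E_{1-k,1-k})`, where `u = t^{1/2}`
and `k = m + 1`. -/
def normalD (u : ℂ) : Module.End ℂ Fock :=
  opSum (fun m : ℕ => (u ^ (2 * m + 1) - (u ^ (2 * m + 1))⁻¹) •
      (E (m + 1) (m + 1) - E (-m) (-m))) fun v =>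
    (((E_finite v).preimage (f := fun m : ℕ => (m : ℤ) + 1)
        (fun a _ b _ h => by simpa using h)).union
      ((E_finite v).preimage (f := fun m : ℕ => -(m : ℤ))
        (fun a _ b _ h => by simpa using h))).subset fun m hm => by
      by_contra hn
      simp only [Set.mem_union, Set.mem_preimage, Function.mem_support, not_or, not_not] at hn
      exact hm (by simp [hn.1, hn.2])

/-- `D(t) = :D(t): + 2 / (t^{1/2} - t^{-1/2}) · C`, where `u = t^{1/2}` and the central element
`C` acts on the Fock space of one pair of fermions as the identity. -/
def D (u : ℂ) : Module.End ℂ Fock := normalD u + (2 / (u - u⁻¹)) • 1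

/-- The action of `τ = [[0, 1], [1, 0]] ∈ O(2)`: it fixes the vacuum and exchanges `ψ⁺_n` and
`ψ⁻_n` for every `n`. -/
def tau : Module.End ℂ Fock :=
  (ExteriorAlgebra.map (Finsupp.lmapDomain ℂ ℂ fun a : Mode => (!a.1, a.2))).toLinearMap

/-- The `ε`-eigenspace of `τ` on the charge-zero subspace of the Fock space. -/
def chargeZero (ε : ℂ) : Submodule ℂ Fock :=
  LinearMap.ker charge ⊓ Module.End.eigenspace tau ε

/-- `tr_W q^{L₀} A = z` for an operator `A` on a space `W` of states: `W` is the sum of its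
subspaces `W_n` of energy `n = 0, 1, 2, …`, each `W_n` is finite-dimensional and stable under `A`,
and the series `∑_n q^n tr(A | W_n)` converges absolutely to `z`. -/
def HasQTrace (q : ℂ) (A : Module.End ℂ Fock) (W : Submodule ℂ Fock) (z : ℂ) : Prop :=
  (W = ⨆ n : ℕ, W ⊓ energy.eigenspace (n : ℂ)) ∧
  (∀ n : ℕ, FiniteDimensional ℂ (W ⊓ energy.eigenspace (n : ℂ) : Submodule ℂ Fock)) ∧
  ∃ h : ∀ n : ℕ, ∀ v ∈ W ⊓ energy.eigenspace (n : ℂ), A v ∈ W ⊓ energy.eigenspace (n : ℂ),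
    HasSum (fun n : ℕ => q ^ n * LinearMap.trace ℂ _ (A.restrict (h n))) z

/-- `(a; q)_∞ = ∏_{r ≥ 0} (1 - a q^r)`. -/
def qPoch (a q : ℂ) : ℂ := ∏' r : ℕ, (1 - a * q ^ r)

/-- `Θ(t) = (t^{1/2} - t^{-1/2}) (q;q)_∞^{-2} (qt;q)_∞ (qt⁻¹;q)_∞`, where `u = t^{1/2}`. -/
def Theta (q u : ℂ) : ℂ :=
  (u - u⁻¹) * (qPoch q q ^ 2)⁻¹ * qPoch (q * u ^ 2) q * qPoch (q * (u ^ 2)⁻¹) q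

/-- The summand `q^{r+1} t^{-1/2} / (1 - q^{2(r+1)} t⁻¹) - q^{r+1} t^{1/2} / (1 - q^{2(r+1)} t)`,
where `u = t^{1/2}`. -/
def lambertTerm (q u : ℂ) (r : ℕ) : ℂ :=
  q ^ (r + 1) * u⁻¹ / (1 - q ^ (2 * (r + 1)) * (u ^ 2)⁻¹) -
    q ^ (r + 1) * u / (1 - q ^ (2 * (r + 1)) * u ^ 2)

/-- `(t^{-1/2};q)_∞ (q t^{1/2};q)_∞ / ((-t^{-1/2};q)_∞ (-q t^{1/2};q)_∞)`, where `u = t^{1/2}`. -/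
def pochRatio (q u : ℂ) : ℂ :=
  qPoch u⁻¹ q * qPoch (q * u) q / (qPoch (-u⁻¹) q * qPoch (-(q * u)) q)

end FermionFock

end

/-!
The exterior algebra on the creation modes has a basis `fockBasis` indexed by the finite sets `S`
of modes. Each `create a * annihilate a` acts on it as the indicator of `a ∈ S`, so the charge,
`L₀` and `D(t)` are diagonal, with eigenvalues `chargeOf S`, `degree S / 2` and `eigD u S`. The
involution `τ` maps `fockBasis S` to a multiple of `fockBasis (swapSet S)`, where `swapSet`
exchanges the two kinds of modes; on a fixed set `S = univ ×ˢ A` the multiple is `(-1)^|A|`, one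
sign for every exchanged pair (`tau_fockBasis_univ_product`). Since `(1 + ε τ) / 2` projects onto
the `ε`-eigenspace of `τ`, the trace is half the sum of `q^(degree S / 2) * eigD u S` over the
sets of charge zero, plus `ε / 2` times the same sum over the fixed sets with the sign inserted
(`hasQTrace_of_hasSum`).

The signed sum (`hasSum_tau_part`) runs over the finite sets `A` of naturals and is the expansion
of the product `∏ (1 - q^(2m+1)) = (q; q²)_∞`, in which marking the occupied mode `m` inserts the
factor `-q^(2m+1) / (1 - q^(2m+1))`. Expanding that factor as a geometric series and summing over
`m` first gives the Lambert series.

For the unsigned sum (`hasSum_symmetric_part`) put `q = p²`. Counting the sets of charge `c`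
inside a finite box of modes gives `p^(c²)` times a Gaussian binomial coefficient, by the two
Pascal rules; hence all sets of charge `c` have generating function `p^(c²) / (q; q)_∞`
(`chargeSum_eq`), which is Jacobi's triple product identity read off coefficientwise. Emptying a
mode changes the charge by one, so the generating function of the sets of charge zero containing a
given mode is an alternating sum of these (`hasSum_occupiedSum`). Summing over the modes leaves,
up to a factor, `1 + ∑ (-1)^j q^((j+1)(j+2)/2) ((t - 1)/(1 - q^(j+1) t) - (1 - t⁻¹)/(1 - q^(j+1)
t⁻¹))`, and this is the partial fraction expansion of `(q; q)_∞² / ((qt; q)_∞ (qt⁻¹; q)_∞)`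
(`hasSum_partial_fractions`), obtained by Tannery's theorem from the expansion of the finite
products (`partial_fractions_finite`).

The second form of the answer differs only in the bracket: the logarithmic derivative of the ratio
of infinite products is computed factor by factor (`logDeriv_pochRatio`).
-/

namespace FermionFock

/-! ### The `q`-Pochhammer symbol and partial fractions of finite products -/

theorem summable_norm_mul_pow {q : ℂ} (hq : ‖q‖ < 1) (a : ℂ) :
    Summable fun r : ℕ => ‖a * q ^ r‖ := by
  simp only [norm_mul, norm_pow]
  exact (summable_geometric_of_lt_one (norm_nonneg q) hq).mul_left _

theorem tendsto_prod_qPoch {q : ℂ} (hq : ‖q‖ < 1) (a : ℂ) :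
    Tendsto (fun n => ∏ r ∈ Finset.range n, (1 - a * q ^ r)) atTop (𝓝 (qPoch a q)) := by
  have h : Multipliable fun r : ℕ => 1 + -(a * q ^ r) :=
    multipliable_one_add_of_summable (by simpa only [norm_neg] using summable_norm_mul_pow hq a)
  simp only [← sub_eq_add_neg] at h
  exact h.hasProd.tendsto_prod_nat

theorem qPoch_ne_zero {q a : ℂ} (hq : ‖q‖ < 1) (h : ∀ r : ℕ, 1 - a * q ^ r ≠ 0) :
    qPoch a q ≠ 0 := by
  have := tprod_one_add_ne_zero_of_summable (f := fun r : ℕ => -(a * q ^ r))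
    (by simpa only [← sub_eq_add_neg] using h)
    (by simpa only [norm_neg] using summable_norm_mul_pow hq a)
  simp only [← sub_eq_add_neg] at this
  exact this

theorem one_sub_ne_zero_of_norm_lt_one {z : ℂ} (h : ‖z‖ < 1) : 1 - z ≠ 0 := by
  intro h0
  rw [← sub_eq_zero.1 h0, norm_one] at h
  exact lt_irrefl _ h

theorem norm_sq_lt_one {p : ℂ} (hp : ‖p‖ < 1) : ‖p ^ 2‖ < 1 := by
  rw [norm_pow]; exact pow_lt_one₀ (norm_nonneg _) hp two_ne_zero

theorem one_sub_pow_succ_ne_zero {q : ℂ} (hq : ‖q‖ < 1) (r : ℕ) : 1 - q ^ (r + 1) ≠ 0 :=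
  one_sub_ne_zero_of_norm_lt_one (by
    rw [norm_pow]; exact pow_lt_one₀ (norm_nonneg _) hq r.succ_ne_zero)

/-- `(q; q)_n = ∏_{r=1}^{n} (1 - q^r)`. -/
noncomputable def qFact (q : ℂ) (n : ℕ) : ℂ := ∏ r ∈ Finset.range n, (1 - q ^ (r + 1))

theorem qFact_zero (q : ℂ) : qFact q 0 = 1 := by simp [qFact]

theorem qFact_succ (q : ℂ) (n : ℕ) : qFact q (n + 1) = qFact q n * (1 - q ^ (n + 1)) :=
  Finset.prod_range_succ _ _

theorem qFact_ne_zero {q : ℂ} (hq : ‖q‖ < 1) (n : ℕ) : qFact q n ≠ 0 :=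
  Finset.prod_ne_zero_iff.2 fun r _ => one_sub_pow_succ_ne_zero hq r

theorem tendsto_qFact {q : ℂ} (hq : ‖q‖ < 1) : Tendsto (qFact q) atTop (𝓝 (qPoch q q)) := by
  refine (tendsto_prod_qPoch hq q).congr fun n => ?_
  simp only [qFact, pow_succ']

theorem qPoch_self_ne_zero {q : ℂ} (hq : ‖q‖ < 1) : qPoch q q ≠ 0 :=
  qPoch_ne_zero hq fun r => by
    have := one_sub_pow_succ_ne_zero hq r
    rwa [pow_succ'] at this

/-- The coefficient `(q;q)_n² / ((q;q)_{n-j} (q;q)_{n+j})`, up to sign and a power of `q`, of the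
pole at `t = q^{±j}` in the partial fraction expansion of `(q;q)_n² / ∏_{k=1}^{n} (1 - q^k t)(1 -
q^k t⁻¹)`, for `j ≤ n`. -/
noncomputable def pfCoeff (q : ℂ) (n j : ℕ) : ℂ :=
  qFact q n ^ 2 / (qFact q (n - j) * qFact q (n + j))

/-- The summand of the partial fraction expansion belonging to the poles `t = q^{±j}`. -/
noncomputable def poleTerm (q t : ℂ) (j : ℕ) : ℂ :=
  (t - 1) / (1 - q ^ j * t) - (1 - t⁻¹) / (1 - q ^ j * t⁻¹)

theorem pfCoeff_succ_right {q : ℂ} (hq : ‖q‖ < 1) {n j : ℕ} (hj : j < n) :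
    pfCoeff q n j * (1 - q ^ (n - j)) = pfCoeff q n (j + 1) * (1 - q ^ (n + j + 1)) := by
  obtain ⟨k, rfl⟩ := Nat.exists_eq_add_of_lt hj
  have e1 : j + k + 1 - j = k + 1 := by omega
  have e2 : j + k + 1 - (j + 1) = k := by omega
  have e3 : j + k + 1 + (j + 1) = j + k + 1 + j + 1 := by omega
  rw [pfCoeff, pfCoeff, e1, e2, e3, qFact_succ q k, qFact_succ q (j + k + 1 + j)]
  have := qFact_ne_zero hq k
  have := qFact_ne_zero hq (j + k + 1 + j)
  have := one_sub_pow_succ_ne_zero hq k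
  have := one_sub_pow_succ_ne_zero hq (j + k + 1 + j)
  field_simp

theorem pfCoeff_succ_left {q : ℂ} (hq : ‖q‖ < 1) {n j : ℕ} (hj : j ≤ n) :
    pfCoeff q (n + 1) j * ((1 - q ^ (n + 1 - j)) * (1 - q ^ (n + 1 + j))) =
      (1 - q ^ (n + 1)) ^ 2 * pfCoeff q n j := by
  obtain ⟨k, rfl⟩ := Nat.exists_eq_add_of_le hj
  have e1 : j + k + 1 - j = k + 1 := by omega
  have e2 : j + k - j = k := by omega
  have e3 : j + k + 1 + j = j + k + j + 1 := by omega
  rw [pfCoeff, pfCoeff, e1, e2, e3, qFact_succ q k, qFact_succ q (j + k + j), qFact_succ q (j + k)]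
  have := qFact_ne_zero hq k
  have := qFact_ne_zero hq (j + k + j)
  have := one_sub_pow_succ_ne_zero hq k
  have := one_sub_pow_succ_ne_zero hq (j + k + j)
  field_simp

/-- The value of the partial fraction expansion at infinity: up to normalization this is the
vanishing alternating sum `∑_k (-1)^k q^{k(k-1)/2} [2n; k]` of Gaussian binomials, folded about
its centre. -/
theorem sum_pfCoeff {p : ℂ} (hp : ‖p ^ 2‖ < 1) {n : ℕ} (hn : n ≠ 0) :
    ∑ j ∈ Finset.range n,
      (-1) ^ j * p ^ (j * (j + 1)) * (1 + (p ^ 2) ^ (j + 1)) * pfCoeff (p ^ 2) n (j + 1) = 1 := by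
  have hn1 : 1 - (p ^ 2) ^ n ≠ 0 := by
    obtain ⟨m, rfl⟩ := Nat.exists_eq_succ_of_ne_zero hn
    exact one_sub_pow_succ_ne_zero hp m
  -- the sum telescopes: its partial sums are single terms up to the constant `1`
  have key (J : ℕ) (hJ : J ≤ n) : ∑ j ∈ Finset.range J,
      (-1) ^ j * p ^ (j * (j + 1)) * (1 + (p ^ 2) ^ (j + 1)) * pfCoeff (p ^ 2) n (j + 1) =
      1 - (-1) ^ J * p ^ (J * (J + 1)) * (pfCoeff (p ^ 2) n J * (1 - (p ^ 2) ^ (n - J))) /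
        (1 - (p ^ 2) ^ n) := by
    induction J with
    | zero =>
      have := qFact_ne_zero hp n
      simp only [Finset.range_zero, Finset.sum_empty, pfCoeff, Nat.sub_zero, Nat.add_zero]
      field_simp
      ring
    | succ J ih =>
      rw [Finset.sum_range_succ, ih (by omega), pfCoeff_succ_right hp (by omega)]
      obtain ⟨k, rfl⟩ := Nat.exists_eq_add_of_lt (show J < n by omega)
      have e : J + k + 1 - (J + 1) = k := by omega
      rw [e]
      generalize pfCoeff (p ^ 2) (J + k + 1) (J + 1) = c
      field_simp
      ring
  rw [key n le_rfl]
  simp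

/-- Multiplying the `j`-th summand by the `n`-th factor of the denominator: `(1 - q^n t)(1 - q^n
t⁻¹)` is `q^{n-j} (1 - q^j t)(1 - q^j t⁻¹) + (1 - q^{n-j})(1 - q^{n+j})`. -/
theorem pole_mul_eq {q t : ℂ} (ht : t ≠ 0) {n j : ℕ} (hj : j ≤ n)
    (h1 : 1 - q ^ j * t ≠ 0) (h2 : 1 - q ^ j * t⁻¹ ≠ 0) :
    (1 - q ^ n * t) * (1 - q ^ n * t⁻¹) * poleTerm q t j =
      q ^ (n - j) * (1 + q ^ j) * (t + t⁻¹ - 2) +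
        (1 - q ^ (n - j)) * (1 - q ^ (n + j)) * poleTerm q t j := by
  obtain ⟨k, rfl⟩ := Nat.exists_eq_add_of_le hj
  have e1 : j + k - j = k := by omega
  rw [e1, poleTerm, pow_add, pow_add, pow_add]
  have h2' : t - q ^ j ≠ 0 := by
    intro h; apply h2; field_simp; rw [h, mul_zero]
  generalize q ^ k = b at *
  generalize q ^ j = a at *
  field_simp
  ring

/-- Partial fraction expansion of `(q;q)_n² / ∏_{k=1}^{n} (1 - q^k t)(1 - q^k t⁻¹)`, where `q =
p²` makes the exponents `j(j+1)/2` of `q` integral powers of `p`. -/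
theorem partial_fractions_finite {p t : ℂ} (hp : ‖p ^ 2‖ < 1) (ht : t ≠ 0)
    (h1 : ∀ j : ℕ, 1 - (p ^ 2) ^ (j + 1) * t ≠ 0) (h2 : ∀ j : ℕ, 1 - (p ^ 2) ^ (j + 1) * t⁻¹ ≠ 0)
    (n : ℕ) :
    (∏ j ∈ Finset.range n, (1 - (p ^ 2) ^ (j + 1) * t) * (1 - (p ^ 2) ^ (j + 1) * t⁻¹)) *
      (1 + ∑ j ∈ Finset.range n, (-1) ^ j * p ^ ((j + 1) * (j + 2)) * pfCoeff (p ^ 2) n (j + 1) *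
        poleTerm (p ^ 2) t (j + 1)) = qFact (p ^ 2) n ^ 2 := by
  induction n with
  | zero => simp [qFact]
  | succ n ih =>
    -- passing from `n` to `n + 1` multiplies the expansion by the new factor, because the
    -- terms without a pole that appear on the way cancel by `sum_pfCoeff`
    have hstep : (1 - (p ^ 2) ^ (n + 1) * t) * (1 - (p ^ 2) ^ (n + 1) * t⁻¹) *
        (1 + ∑ j ∈ Finset.range (n + 1), (-1) ^ j * p ^ ((j + 1) * (j + 2)) *
          pfCoeff (p ^ 2) (n + 1) (j + 1) * poleTerm (p ^ 2) t (j + 1)) =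
        (1 - (p ^ 2) ^ (n + 1)) ^ 2 * (1 + ∑ j ∈ Finset.range n, (-1) ^ j *
          p ^ ((j + 1) * (j + 2)) * pfCoeff (p ^ 2) n (j + 1) * poleTerm (p ^ 2) t (j + 1)) := by
      have hterm (j : ℕ) (hj : j ≤ n) :
          (1 - (p ^ 2) ^ (n + 1) * t) * (1 - (p ^ 2) ^ (n + 1) * t⁻¹) *
            ((-1) ^ j * p ^ ((j + 1) * (j + 2)) *
              pfCoeff (p ^ 2) (n + 1) (j + 1) * poleTerm (p ^ 2) t (j + 1)) =
          (p ^ 2) ^ (n + 1) * (t + t⁻¹ - 2) * ((-1) ^ j * p ^ (j * (j + 1)) *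
            (1 + (p ^ 2) ^ (j + 1)) * pfCoeff (p ^ 2) (n + 1) (j + 1)) +
          (-1) ^ j * p ^ ((j + 1) * (j + 2)) * (pfCoeff (p ^ 2) (n + 1) (j + 1) *
            ((1 - (p ^ 2) ^ (n + 1 - (j + 1))) * (1 - (p ^ 2) ^ (n + 1 + (j + 1))))) *
              poleTerm (p ^ 2) t (j + 1) := by
        have h3 := pole_mul_eq ht (show j + 1 ≤ n + 1 by omega) (h1 j) (h2 j)
        have h4 : p ^ ((j + 1) * (j + 2)) * (p ^ 2) ^ (n + 1 - (j + 1)) =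
            (p ^ 2) ^ (n + 1) * p ^ (j * (j + 1)) := by
          obtain ⟨k, rfl⟩ := Nat.exists_eq_add_of_le hj
          have e : j + k + 1 - (j + 1) = k := by omega
          rw [e, ← pow_mul, ← pow_mul, ← pow_add, ← pow_add]
          congr 1; ring
        linear_combination ((-1) ^ j * p ^ ((j + 1) * (j + 2)) *
              pfCoeff (p ^ 2) (n + 1) (j + 1)) * h3 + (-1) ^ j * pfCoeff (p ^ 2) (n + 1) (j + 1) *
              (1 + (p ^ 2) ^ (j + 1)) * (t + t⁻¹ - 2) * h4
      rw [mul_add, Finset.mul_sum, Finset.sum_congr rfl fun j hj =>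
        hterm j (Nat.lt_succ_iff.1 (Finset.mem_range.1 hj)), Finset.sum_add_distrib,
        ← Finset.mul_sum, sum_pfCoeff hp n.succ_ne_zero, Finset.sum_range_succ]
      have h5 : ∑ j ∈ Finset.range n, (-1) ^ j * p ^ ((j + 1) * (j + 2)) *
          (pfCoeff (p ^ 2) (n + 1) (j + 1) *
            ((1 - (p ^ 2) ^ (n + 1 - (j + 1))) * (1 - (p ^ 2) ^ (n + 1 + (j + 1))))) *
              poleTerm (p ^ 2) t (j + 1) = (1 - (p ^ 2) ^ (n + 1)) ^ 2 * ∑ j ∈ Finset.range n,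
            (-1) ^ j * p ^ ((j + 1) * (j + 2)) * pfCoeff (p ^ 2) n (j + 1) *
              poleTerm (p ^ 2) t (j + 1) := by
        rw [Finset.mul_sum]
        refine Finset.sum_congr rfl fun j hj => ?_
        rw [pfCoeff_succ_left hp (Finset.mem_range.1 hj)]
        ring
      rw [h5]
      simp only [Nat.sub_self, pow_zero, sub_self]
      field_simp
      ring
    rw [Finset.prod_range_succ, mul_assoc, hstep, qFact_succ, mul_pow, ← ih]
    ring

/-! ### Partial fractions of the infinite product -/

theorem exists_bound_of_tendsto {f : ℕ → ℂ} {a : ℂ} (h : Tendsto f atTop (𝓝 a)) :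
    ∃ C : ℝ, 0 ≤ C ∧ ∀ n, ‖f n‖ ≤ C := by
  obtain ⟨C, hC⟩ := h.norm.bddAbove_range
  exact ⟨C, (norm_nonneg _).trans (hC ⟨0, rfl⟩), fun n => hC ⟨n, rfl⟩⟩

theorem tendsto_pfCoeff {q : ℂ} (hq : ‖q‖ < 1) (j : ℕ) :
    Tendsto (fun n => pfCoeff q n j) atTop (𝓝 1) := by
  have h := tendsto_qFact hq
  have h0 := qPoch_self_ne_zero hq
  have h1 := (h.pow 2).div ((h.comp (tendsto_sub_atTop_nat j)).mul
    (h.comp (tendsto_add_atTop_nat j))) (mul_ne_zero h0 h0)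
  rwa [← sq, div_self (pow_ne_zero 2 h0)] at h1

theorem exists_bound_pfCoeff {q : ℂ} (hq : ‖q‖ < 1) :
    ∃ C : ℝ, 0 ≤ C ∧ ∀ n j, ‖pfCoeff q n j‖ ≤ C := by
  have h := tendsto_qFact hq
  obtain ⟨C, hC0, hC⟩ := exists_bound_of_tendsto h
  obtain ⟨B, hB0, hB⟩ := exists_bound_of_tendsto (h.inv₀ (qPoch_self_ne_zero hq))
  refine ⟨C ^ 2 * (B * B), by positivity, fun n j => ?_⟩
  rw [pfCoeff, div_eq_mul_inv, mul_inv, norm_mul, norm_mul, norm_pow]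
  gcongr
  · exact hC n
  · exact hB _
  · exact hB _

theorem exists_bound_poleTerm {q : ℂ} (hq : ‖q‖ < 1) (t : ℂ) :
    ∃ C : ℝ, 0 ≤ C ∧ ∀ j, ‖poleTerm q t j‖ ≤ C := by
  have hq0 := tendsto_pow_atTop_nhds_zero_of_norm_lt_one hq
  have h (a b : ℂ) : Tendsto (fun j : ℕ => a / (1 - q ^ j * b)) atTop (𝓝 (a / (1 - 0 * b))) :=
    tendsto_const_nhds.div ((hq0.mul_const b).const_sub 1) (by simp)
  exact exists_bound_of_tendsto ((h (t - 1) t).sub (h (1 - t⁻¹) t⁻¹))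

theorem norm_pow_mul_succ_le {p : ℂ} (hp : ‖p‖ < 1) (j : ℕ) :
    ‖p ^ ((j + 1) * (j + 2))‖ ≤ ‖p‖ ^ j := by
  rw [norm_pow]
  exact pow_le_pow_of_le_one (norm_nonneg _) hp.le (by nlinarith)

/-- Partial fraction expansion of `(q;q)_∞² / ((qt;q)_∞ (qt⁻¹;q)_∞)`, for `q = p²`. -/
theorem hasSum_partial_fractions {p t : ℂ} (hp1 : ‖p‖ < 1) (ht : t ≠ 0)
    (h1 : ∀ j : ℕ, 1 - (p ^ 2) ^ (j + 1) * t ≠ 0) (h2 : ∀ j : ℕ, 1 - (p ^ 2) ^ (j + 1) * t⁻¹ ≠ 0) :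
    HasSum (fun j : ℕ => (-1) ^ j * p ^ ((j + 1) * (j + 2)) * poleTerm (p ^ 2) t (j + 1))
      (qPoch (p ^ 2) (p ^ 2) ^ 2 /
        (qPoch (p ^ 2 * t) (p ^ 2) * qPoch (p ^ 2 * t⁻¹) (p ^ 2)) - 1) := by
  have hp := norm_sq_lt_one hp1
  obtain ⟨C, hC0, hC⟩ := exists_bound_pfCoeff hp
  obtain ⟨B, hB0, hB⟩ := exists_bound_poleTerm hp t
  have hgeom := summable_geometric_of_lt_one (norm_nonneg p) hp1
  have hsum : Summable fun j : ℕ =>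
      (-1) ^ j * p ^ ((j + 1) * (j + 2)) * poleTerm (p ^ 2) t (j + 1) := by
    refine (hgeom.mul_right B).of_norm_bounded fun j => ?_
    rw [norm_mul, norm_mul, norm_pow, norm_neg, norm_one, one_pow, one_mul]
    have := norm_pow_mul_succ_le hp1 j
    have := hB (j + 1)
    gcongr
  have hlim : Tendsto (fun n : ℕ => ∑' j : ℕ, if j < n then
      (-1) ^ j * p ^ ((j + 1) * (j + 2)) * pfCoeff (p ^ 2) n (j + 1) * poleTerm (p ^ 2) t (j + 1)
      else 0) atTop (𝓝 (∑' j : ℕ,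
        (-1) ^ j * p ^ ((j + 1) * (j + 2)) * poleTerm (p ^ 2) t (j + 1))) := by
    refine tendsto_tsum_of_dominated_convergence (hgeom.mul_right (C * B)) (fun j => ?_)
      (Eventually.of_forall fun n j => ?_)
    · have h3 := ((tendsto_pfCoeff hp (j + 1)).const_mul
        ((-1) ^ j * p ^ ((j + 1) * (j + 2)))).mul_const (poleTerm (p ^ 2) t (j + 1))
      rw [mul_one] at h3
      refine h3.congr' ?_
      filter_upwards [eventually_gt_atTop j] with n hn
      rw [if_pos hn]
    · split_ifs
      · rw [norm_mul, norm_mul, norm_mul, norm_pow, norm_neg, norm_one, one_pow, one_mul, mul_assoc]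
        have := norm_pow_mul_succ_le hp1 j
        have := hB (j + 1)
        have := hC n (j + 1)
        gcongr
      · rw [norm_zero]; positivity
  have hfin (n : ℕ) : (∑' j : ℕ, if j < n then
      (-1) ^ j * p ^ ((j + 1) * (j + 2)) * pfCoeff (p ^ 2) n (j + 1) * poleTerm (p ^ 2) t (j + 1)
      else 0) = ∑ j ∈ Finset.range n,
      (-1) ^ j * p ^ ((j + 1) * (j + 2)) * pfCoeff (p ^ 2) n (j + 1) *
        poleTerm (p ^ 2) t (j + 1) := by
    rw [tsum_eq_sum (s := Finset.range n) fun j hj => if_neg (by simpa using hj)]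
    exact Finset.sum_congr rfl fun j hj => if_pos (Finset.mem_range.1 hj)
  simp only [hfin] at hlim
  have hq1 : qPoch (p ^ 2 * t) (p ^ 2) ≠ 0 := qPoch_ne_zero hp fun r => by
    have := h1 r
    rwa [pow_succ, mul_assoc, mul_comm] at this
  have hq2 : qPoch (p ^ 2 * t⁻¹) (p ^ 2) ≠ 0 := qPoch_ne_zero hp fun r => by
    have := h2 r
    rwa [pow_succ, mul_assoc, mul_comm] at this
  have hprod : Tendsto (fun n => ∏ j ∈ Finset.range n,
      (1 - (p ^ 2) ^ (j + 1) * t) * (1 - (p ^ 2) ^ (j + 1) * t⁻¹)) atTop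
      (𝓝 (qPoch (p ^ 2 * t) (p ^ 2) * qPoch (p ^ 2 * t⁻¹) (p ^ 2))) := by
    refine ((tendsto_prod_qPoch hp _).mul (tendsto_prod_qPoch hp _)).congr fun n => ?_
    rw [← Finset.prod_mul_distrib]
    refine Finset.prod_congr rfl fun j _ => ?_
    ring
  have hall := hprod.mul (hlim.const_add 1)
  simp only [partial_fractions_finite hp ht h1 h2] at hall
  have hfinal := tendsto_nhds_unique hall ((tendsto_qFact hp).pow 2)
  rw [hsum.hasSum_iff, ← hfinal, mul_div_cancel_left₀ _ (mul_ne_zero hq1 hq2)]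
  ring

/-! ### The monomial basis of the Fock space -/

/-- The product `a₁ ∧ ⋯ ∧ a_k` of a list of creation modes, applied to the vacuum. The list may
have repetitions, in which case the product vanishes. -/
noncomputable def wedge (L : List Mode) : Fock :=
  (L.map fun a => ExteriorAlgebra.ι ℂ (Finsupp.single a (1 : ℂ))).prod

theorem wedge_cons (a : Mode) (L : List Mode) : wedge (a :: L) = create a (wedge L) := by
  simp [wedge, create]

theorem annihilate_create (a b : Mode) (x : Fock) :
    annihilate a (create b x) = (if a = b then x else 0) - create b (annihilate a x) := by
  have h := CliffordAlgebra.contractLeft_ι_mul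
    (Q := (0 : QuadraticForm ℂ (Mode →₀ ℂ))) (Finsupp.lapply a : (Mode →₀ ℂ) →ₗ[ℂ] ℂ)
    (Finsupp.single b 1) x
  refine h.trans ?_
  congr 1
  by_cases hab : a = b
  · subst hab; simp
  · simp [hab]

theorem create_create_self (a : Mode) (x : Fock) : create a (create a x) = 0 := by
  simp [create, ← mul_assoc]

theorem create_create_comm (a b : Mode) (x : Fock) :
    create a (create b x) = -create b (create a x) := by
  have h := ExteriorAlgebra.ι_add_mul_swap (R := ℂ) (Finsupp.single a (1 : ℂ))
    (Finsupp.single b (1 : ℂ))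
  have h2 := congrArg (· * x) h
  simp only [add_mul, zero_mul, mul_assoc] at h2
  exact eq_neg_of_add_eq_zero_left h2

theorem annihilate_one (a : Mode) : annihilate a 1 = 0 := by
  simp [annihilate]

/-- The number operator of the mode `a` on a product of modes. A repeated mode does no harm, since
then the product is zero. -/
theorem create_annihilate_wedge (a : Mode) (L : List Mode) :
    create a (annihilate a (wedge L)) = if a ∈ L then wedge L else 0 := by
  induction L with
  | nil => simp [wedge, annihilate_one]
  | cons b L ih =>
    rw [wedge_cons, annihilate_create]
    by_cases hab : a = b
    · subst hab
      simp [map_sub, create_create_self]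
    · rw [if_neg hab, zero_sub, map_neg, create_create_comm, neg_neg, ih]
      by_cases hL : a ∈ L <;> simp [hab, hL]

theorem annihilate_wedge_of_notMem {a : Mode} {L : List Mode} (h : a ∉ L) :
    annihilate a (wedge L) = 0 := by
  induction L with
  | nil => simp [wedge, annihilate_one]
  | cons b L ih =>
    simp only [List.mem_cons, not_or] at h
    rw [wedge_cons, annihilate_create, if_neg h.1, ih h.2]
    simp

theorem wedge_ne_zero {L : List Mode} (h : L.Nodup) : wedge L ≠ 0 := by
  induction L with
  | nil => simp [wedge]
  | cons a L ih =>
    rw [List.nodup_cons] at h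
    intro h0
    have h1 := congrArg (annihilate a) h0
    rw [wedge_cons, annihilate_create, annihilate_wedge_of_notMem h.1] at h1
    exact ih h.2 (by simpa using h1)

/-- The Fock space has a basis indexed by the finite sets of modes, whose member at `S` is the
product of the modes in `S` in some order. The order affects only signs and is left unspecified.
-/
theorem exists_basis : ∃ b : Module.Basis (Finset Mode) ℂ Fock,
    ∀ S, ∃ L : List Mode, (∀ a, a ∈ L ↔ a ∈ S) ∧ b S = wedge L := by
  -- the basis of an exterior algebra needs a linear order on the index type
  let e : Mode ≃ Bool ×ₗ ℕ := toLex
  let b0 : Module.Basis (Bool ×ₗ ℕ) ℂ (Mode →₀ ℂ) := Finsupp.basisSingleOne.reindex e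
  refine ⟨b0.ExteriorAlgebra.reindex e.symm.finsetCongr, fun S => ?_⟩
  have h := ExteriorAlgebra.basis_apply_ofCard b0 (s := S.map e.toEmbedding) rfl
  refine ⟨List.ofFn fun i => e.symm ((S.map e.toEmbedding).orderEmbOfFin rfl i), fun a => ?_, ?_⟩
  · have hr : e a ∈ Set.range ((S.map e.toEmbedding).orderEmbOfFin rfl) ↔ a ∈ S := by
      rw [Finset.range_orderEmbOfFin]; simp
    rw [← hr, List.mem_ofFn, Set.mem_range]
    exact exists_congr fun i => e.symm_apply_eq
  · rw [Module.Basis.reindex_apply]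
    refine Eq.trans ?_ (h.trans ?_)
    · simp
    · refine (ExteriorAlgebra.ιMulti_apply _).trans ?_
      rw [wedge, List.map_ofFn]
      congr 2
      funext i
      simp only [b0, Function.comp_apply, Module.Basis.reindex_apply, Finsupp.coe_basisSingleOne]
      rfl

/-! ### Diagonal operators on the Fock space -/

/-- A basis of the Fock space consisting of products of modes, indexed by the finite sets of
modes. -/
noncomputable def fockBasis : Module.Basis (Finset Mode) ℂ Fock := exists_basis.choose

theorem exists_wedge_eq_fockBasis (S : Finset Mode) :
    ∃ L : List Mode, (∀ a, a ∈ L ↔ a ∈ S) ∧ fockBasis S = wedge L :=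
  exists_basis.choose_spec S

theorem create_annihilate_fockBasis (a : Mode) (S : Finset Mode) :
    create a (annihilate a (fockBasis S)) = (if a ∈ S then (1 : ℂ) else 0) • fockBasis S := by
  obtain ⟨L, hL, h⟩ := exists_wedge_eq_fockBasis S
  rw [h, create_annihilate_wedge]
  simp [hL]

theorem repr_of_diagonal {A : Module.End ℂ Fock} {d : Finset Mode → ℂ}
    (h : ∀ S, A (fockBasis S) = d S • fockBasis S) (v : Fock) (S : Finset Mode) :
    fockBasis.repr (A v) S = d S * fockBasis.repr v S := by
  have h2 : Finsupp.lapply S ∘ₗ fockBasis.repr.toLinearMap ∘ₗ A =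
      d S • (Finsupp.lapply S ∘ₗ fockBasis.repr.toLinearMap) := by
    refine fockBasis.ext fun T => ?_
    by_cases hT : T = S
    · subst hT; simp [h]
    · simp [h, hT]
  exact LinearMap.congr_fun h2 v

/-- A product of the modes in `T`, in any order and with any repetitions, is a multiple of
`fockBasis T`: a vector is determined up to a scalar by its eigenvalues under all number
operators. -/
theorem wedge_eq_smul_fockBasis {L : List Mode} {T : Finset Mode} (h : ∀ a, a ∈ L ↔ a ∈ T) :
    ∃ c : ℂ, wedge L = c • fockBasis T := by
  refine ⟨fockBasis.repr (wedge L) T, fockBasis.ext_elem fun U => ?_⟩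
  by_cases hU : T = U
  · subst hU; simp
  · obtain ⟨a, ha⟩ : ∃ a, ¬ (a ∈ T ↔ a ∈ U) := by
      by_contra! hc
      exact hU (Finset.ext hc)
    have h1 := repr_of_diagonal (A := create a * annihilate a)
      (d := fun S => if a ∈ S then (1 : ℂ) else 0) (create_annihilate_fockBasis a) (wedge L) U
    rw [Module.End.mul_apply, create_annihilate_wedge] at h1
    have h0 : fockBasis.repr (wedge L) U = 0 := by
      rw [if_congr (h a) rfl rfl] at h1
      by_cases h2 : a ∈ T <;> by_cases h3 : a ∈ U <;> simp [h2, h3] at h1 ha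
      · exact h1
      · exact h1.symm
    simp [h0, hU]

/-- The charge of a set of modes: the number of modes `ψ⁺` minus the number of modes `ψ⁻`. -/
def chargeOf (S : Finset Mode) : ℤ := ∑ a ∈ S, if a.1 then 1 else -1

/-- Twice the energy of a set of modes; the factor `2` makes it a natural number. -/
def degree (S : Finset Mode) : ℕ := ∑ a ∈ S, (2 * a.2 + 1)

/-- The eigenvalue of `D(t)` on a set of modes, where `u = t^{1/2}`. -/
noncomputable def eigD (u : ℂ) (S : Finset Mode) : ℂ :=
  ∑ a ∈ S, (u ^ (2 * a.2 + 1) - (u ^ (2 * a.2 + 1))⁻¹) + 2 / (u - u⁻¹)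

/-- The index `i` for which `:ψ⁺_{i+1/2} ψ⁻_{-i-1/2}:` is plus or minus the number operator of the
mode. -/
def modeIndex : Mode → ℤ
  | (true, m) => Int.negSucc m
  | (false, m) => m

theorem modeIndex_injective : Function.Injective modeIndex := by
  rintro ⟨_ | _, m⟩ ⟨_ | _, n⟩ h <;> simp [modeIndex] at h ⊢ <;> omega

theorem modeIndex_surjective : Function.Surjective modeIndex
  | Int.ofNat m => ⟨(false, m), rfl⟩
  | Int.negSucc m => ⟨(true, m), rfl⟩

theorem normalOrd_fockBasis (a : Mode) (S : Finset Mode) :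
    normalOrd (modeIndex a) (-modeIndex a - 1) (fockBasis S) =
      (if a ∈ S then (if a.1 then 1 else -1 : ℂ) else 0) • fockBasis S := by
  obtain ⟨_ | _, m⟩ := a
  · have e : -(m : ℤ) - 1 = Int.negSucc m := by rw [Int.negSucc_eq]; ring
    have h := create_annihilate_fockBasis (false, m) S
    have e2 : psi true (m : ℤ) = annihilate (false, m) := rfl
    simp only [modeIndex, e, normalOrd]
    rw [if_pos (by positivity), e2]
    simp only [psi, LinearMap.neg_apply, Module.End.mul_apply, h]
    by_cases hS : (false, m) ∈ S <;> simp [hS]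
  · have e : -Int.negSucc m - 1 = Int.ofNat m := by rw [Int.negSucc_eq]; simp
    have h := create_annihilate_fockBasis (true, m) S
    simp only [modeIndex, e, normalOrd]
    rw [if_neg (by simp)]
    simp only [psi, Module.End.mul_apply]
    simpa using h

theorem finsum_smul_normalOrd_fockBasis (g : ℤ → ℂ) (S : Finset Mode) :
    ∑ᶠ i : ℤ, g i • normalOrd i (-i - 1) (fockBasis S) =
      (∑ a ∈ S, g (modeIndex a) * if a.1 then 1 else -1) • fockBasis S := by
  classical
  rw [finsum_eq_sum_of_support_subset (s := S.image modeIndex),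
    Finset.sum_image fun a _ b _ h => modeIndex_injective h, Finset.sum_smul]
  · refine Finset.sum_congr rfl fun a ha => ?_
    rw [normalOrd_fockBasis, if_pos ha, smul_smul]
  · intro i hi
    obtain ⟨a, rfl⟩ := modeIndex_surjective i
    rw [Function.mem_support, normalOrd_fockBasis] at hi
    by_cases ha : a ∈ S
    · exact Finset.mem_coe.2 (Finset.mem_image_of_mem _ ha)
    · simp [ha] at hi

theorem charge_fockBasis (S : Finset Mode) :
    charge (fockBasis S) = (chargeOf S : ℂ) • fockBasis S := by
  have h := finsum_smul_normalOrd_fockBasis (fun _ => 1) S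
  simp only [one_smul, one_mul] at h
  refine h.trans ?_
  simp [chargeOf]

theorem energy_fockBasis (S : Finset Mode) :
    energy (fockBasis S) = ((degree S : ℂ) / 2) • fockBasis S := by
  refine (finsum_smul_normalOrd_fockBasis (fun i => -((i : ℂ) + 1 / 2)) S).trans ?_
  congr 1
  rw [degree, Nat.cast_sum, Finset.sum_div]
  refine Finset.sum_congr rfl fun a _ => ?_
  obtain ⟨_ | _, m⟩ := a <;> simp [modeIndex, Int.negSucc_eq] <;> ring

theorem normalD_fockBasis (u : ℂ) (S : Finset Mode) :
    normalD u (fockBasis S) =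
      (∑ a ∈ S, (u ^ (2 * a.2 + 1) - (u ^ (2 * a.2 + 1))⁻¹)) • fockBasis S := by
  have hterm (m : ℕ) : (E (m + 1) (m + 1) - E (-m) (-m)) (fockBasis S) =
      (∑ s : Bool, if (s, m) ∈ S then (1 : ℂ) else 0) • fockBasis S := by
    have h1 := normalOrd_fockBasis (true, m) S
    have h2 := normalOrd_fockBasis (false, m) S
    have e1 : (E (m + 1) (m + 1)) = normalOrd (modeIndex (true, m)) (-modeIndex (true, m) - 1) := by
      simp only [E, modeIndex]
      congr 1
    have e2 : (E (-m) (-m)) = normalOrd (modeIndex (false, m)) (-modeIndex (false, m) - 1) := by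
      simp [E, modeIndex]
    rw [LinearMap.sub_apply, e1, e2, h1, h2, ← sub_smul]
    rw [Fintype.sum_bool]
    by_cases hS : (false, m) ∈ S <;> simp [hS]
  obtain ⟨M, hM⟩ : ∃ M, ∀ a ∈ S, a.2 < M :=
    ⟨S.sup (fun a => a.2) + 1, fun a ha => Nat.lt_succ_of_le (Finset.le_sup (f := fun a => a.2) ha)⟩
  have hS : S = (Finset.univ ×ˢ Finset.range M).filter (· ∈ S) := by
    ext a; simpa using fun h => hM a h
  refine (finsum_eq_sum_of_support_subset (s := Finset.range M) _ ?_).trans ?_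
  · intro m hm
    by_contra hn
    refine hm ?_
    have hs (s : Bool) : (s, m) ∉ S := fun h => hn (by simpa using hM _ h)
    simp only [LinearMap.smul_apply, hterm]
    simp [hs]
  · simp only [LinearMap.smul_apply, hterm, smul_smul, ← Finset.sum_smul]
    congr 1
    conv_rhs => rw [hS, Finset.sum_filter, Finset.sum_product_right]
    refine Finset.sum_congr rfl fun m _ => ?_
    rw [Fintype.sum_bool, Fintype.sum_bool]
    simp [mul_add]

theorem D_fockBasis (u : ℂ) (S : Finset Mode) : D u (fockBasis S) = eigD u S • fockBasis S := by
  simp [D, normalD_fockBasis, eigD, add_smul]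

/-! ### The involution `τ` on the basis and traces on its eigenspaces -/

/-- Exchange of the two kinds of modes. -/
def swapMode : Mode ≃ Mode := Equiv.prodCongr Equiv.boolNot (Equiv.refl ℕ)

theorem swapMode_apply (a : Mode) : swapMode a = (!a.1, a.2) := rfl

theorem swapMode_swapMode (a : Mode) : swapMode (swapMode a) = a := by simp [swapMode_apply]

/-- The image of a set of modes under the exchange of the two kinds of modes. -/
def swapSet (S : Finset Mode) : Finset Mode := S.map swapMode.toEmbedding

theorem mem_swapSet {S : Finset Mode} {a : Mode} : a ∈ swapSet S ↔ swapMode a ∈ S := by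
  rw [swapSet, Finset.mem_map]
  constructor
  · rintro ⟨b, hb, rfl⟩
    simpa [swapMode_swapMode] using hb
  · exact fun h => ⟨swapMode a, h, swapMode_swapMode a⟩

theorem chargeOf_swapSet (S : Finset Mode) : chargeOf (swapSet S) = -chargeOf S := by
  rw [chargeOf, swapSet, Finset.sum_map, chargeOf, ← Finset.sum_neg_distrib]
  refine Finset.sum_congr rfl fun a _ => ?_
  cases h : a.1 <;> simp [swapMode_apply, h]

theorem degree_swapSet (S : Finset Mode) : degree (swapSet S) = degree S := by
  rw [degree, swapSet, Finset.sum_map]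
  rfl

theorem eigD_swapSet (u : ℂ) (S : Finset Mode) : eigD u (swapSet S) = eigD u S := by
  rw [eigD, swapSet, Finset.sum_map]
  rfl

theorem tau_create (a : Mode) (x : Fock) : tau (create a x) = create (swapMode a) (tau x) := by
  simp [tau, create, swapMode_apply]

theorem tau_wedge (L : List Mode) : tau (wedge L) = wedge (L.map swapMode) := by
  induction L with
  | nil => simp [wedge, tau]
  | cons a L ih => rw [wedge_cons, tau_create, ih, List.map_cons, wedge_cons]

theorem tau_tau (v : Fock) : tau (tau v) = v := by
  have h : tau ∘ₗ tau = LinearMap.id := by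
    refine fockBasis.ext fun S => ?_
    obtain ⟨L, -, h⟩ := exists_wedge_eq_fockBasis S
    simp only [LinearMap.comp_apply, h, tau_wedge, List.map_map, LinearMap.id_apply]
    congr 1
    conv_rhs => rw [← List.map_id L]
    exact List.map_congr_left fun a _ => swapMode_swapMode a
  exact LinearMap.congr_fun h v

theorem exists_tau_fockBasis (S : Finset Mode) :
    ∃ c : ℂ, tau (fockBasis S) = c • fockBasis (swapSet S) := by
  obtain ⟨L, hL, h⟩ := exists_wedge_eq_fockBasis S
  rw [h, tau_wedge]
  refine wedge_eq_smul_fockBasis fun a => ?_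
  rw [mem_swapSet, ← hL, List.mem_map]
  constructor
  · rintro ⟨b, hb, rfl⟩
    simpa [swapMode_swapMode] using hb
  · exact fun h => ⟨swapMode a, h, swapMode_swapMode a⟩

/-- On a set of modes that is stable under the exchange, `τ` acts by one sign `-1` for every
exchanged pair. The sign does not depend on the order of the modes chosen in `fockBasis`. -/
theorem tau_fockBasis_univ_product (A : Finset ℕ) :
    tau (fockBasis (Finset.univ ×ˢ A)) = (-1 : ℂ) ^ A.card • fockBasis (Finset.univ ×ˢ A) := by
  -- order the modes so that the exchanged ones are adjacent
  let pairs (l : List ℕ) : List Mode := l.flatMap fun m => [(true, m), (false, m)]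
  have hmem (l : List ℕ) (a : Mode) : a ∈ pairs l ↔ a.2 ∈ l := by
    obtain ⟨_ | _, m⟩ := a <;> simp [pairs]
  have hnodup (l : List ℕ) (h : l.Nodup) : (pairs l).Nodup := by
    induction l with
    | nil => simp [pairs]
    | cons m l ih =>
      rw [List.nodup_cons] at h
      have e : pairs (m :: l) = (true, m) :: (false, m) :: pairs l := by simp [pairs]
      rw [e, List.nodup_cons, List.nodup_cons]
      refine ⟨?_, ?_, ih h.2⟩
      · simpa [hmem] using h.1
      · simpa [hmem] using h.1
  have htau (l : List ℕ) : tau (wedge (pairs l)) = (-1 : ℂ) ^ l.length • wedge (pairs l) := by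
    induction l with
    | nil => simp [pairs, wedge, tau]
    | cons m l ih =>
      have e : pairs (m :: l) = (true, m) :: (false, m) :: pairs l := by simp [pairs]
      rw [e, wedge_cons, wedge_cons, tau_create, tau_create, ih]
      have e1 : swapMode (true, m) = (false, m) := rfl
      have e2 : swapMode (false, m) = (true, m) := rfl
      rw [e1, e2, map_smul, map_smul, create_create_comm, List.length_cons, pow_succ]
      simp
  obtain ⟨c, hc⟩ := wedge_eq_smul_fockBasis (L := pairs A.toList) (T := Finset.univ ×ˢ A)
    fun a => by simp [hmem]
  have hc0 : c ≠ 0 := by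
    rintro rfl
    exact wedge_ne_zero (hnodup _ A.nodup_toList) (by simpa using hc)
  have h := htau A.toList
  rw [hc, map_smul, smul_comm, Finset.length_toList] at h
  exact smul_right_injective _ hc0 h

theorem swapSet_eq_self_iff (S : Finset Mode) :
    swapSet S = S ↔ ∃ A : Finset ℕ, S = Finset.univ ×ˢ A := by
  constructor
  · intro h
    refine ⟨S.image Prod.snd, ?_⟩
    ext ⟨s, m⟩
    simp only [Finset.mem_product, Finset.mem_univ, true_and, Finset.mem_image]
    constructor
    · exact fun hS => ⟨_, hS, rfl⟩
    · rintro ⟨⟨s', m'⟩, hS, rfl⟩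
      by_cases hs : s' = s
      · subst hs; exact hS
      · rw [← h, mem_swapSet] at hS
        have : (!s') = s := by cases s <;> cases s' <;> simp_all
        simpa [swapMode_apply, this] using hS
  · rintro ⟨A, rfl⟩
    ext a
    simp [mem_swapSet, swapMode_apply]

/-- The diagonal matrix coefficient of `τ` at `fockBasis S`. -/
noncomputable def tauCoeff (S : Finset Mode) : ℂ :=
  if swapSet S = S then (-1) ^ (S.card / 2) else 0

theorem repr_tau_fockBasis (S : Finset Mode) :
    fockBasis.repr (tau (fockBasis S)) S = tauCoeff S := by
  rw [tauCoeff]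
  split_ifs with h
  · obtain ⟨A, rfl⟩ := (swapSet_eq_self_iff S).1 h
    rw [tau_fockBasis_univ_product]
    simp [Finset.card_product]
  · obtain ⟨c, hc⟩ := exists_tau_fockBasis S
    rw [hc]
    simp [h]

/-- If `P` is the identity on `W`, maps the finitely many basis vectors `b i`, `i ∈ T`, into `W`,
and `W` lies in their span, then the trace of `A` on `W` is the sum of the diagonal coefficients
of `A ∘ P` over `T`. -/
theorem trace_restrict_of_basis {K V I : Type*} [Field K] [AddCommGroup V] [Module K V]
    (b : Module.Basis I K V) (T : Finset I) (W : Submodule K V) (P A : Module.End K V)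
    (hPW : ∀ w ∈ W, P w = w) (hPT : ∀ i ∈ T, P (b i) ∈ W)
    (hT : ∀ w ∈ W, ∀ i ∉ T, b.repr w i = 0) :
    FiniteDimensional K W ∧ ∀ hA : ∀ w ∈ W, A w ∈ W,
      LinearMap.trace K W (A.restrict hA) = ∑ i ∈ T, b.repr (A (P (b i))) i := by
  classical
  let j : W →ₗ[K] (T → K) := LinearMap.pi fun i => (b.coord i) ∘ₗ W.subtype
  let p : (T → K) →ₗ[K] W := LinearMap.codRestrict W
    (∑ i : T, (LinearMap.toSpanSingleton K V (P (b i))) ∘ₗ LinearMap.proj i) fun x => by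
      simp only [LinearMap.sum_apply, LinearMap.comp_apply, LinearMap.toSpanSingleton_apply]
      exact W.sum_mem fun i _ => W.smul_mem _ (hPT _ i.2)
  have hpj : p ∘ₗ j = LinearMap.id := by
    ext w
    have h1 : (w : V) = ∑ i ∈ T, b.repr w i • b i := by
      conv_lhs => rw [← b.linearCombination_repr w, Finsupp.linearCombination_apply]
      refine Finsupp.sum_of_support_subset _ ?_ _ (by simp)
      intro i hi
      by_contra hn
      exact (Finsupp.mem_support_iff.1 hi) (hT w w.2 i hn)
    have h2 := congrArg P h1
    rw [hPW w w.2, map_sum] at h2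
    simp only [map_smul] at h2
    simp only [LinearMap.comp_apply, LinearMap.id_apply]
    conv_rhs => rw [h2, ← Finset.sum_coe_sort]
    simp [p, j, LinearMap.sum_apply]
  have hinj : Function.Injective j := fun x y h => by
    have := congrArg p h
    rw [← LinearMap.comp_apply, ← LinearMap.comp_apply, hpj] at this
    exact this
  have hfin : FiniteDimensional K W := FiniteDimensional.of_injective j hinj
  refine ⟨hfin, fun hA => ?_⟩
  have h1 : A.restrict hA = (A.restrict hA ∘ₗ p) ∘ₗ j := by
    rw [LinearMap.comp_assoc, hpj, LinearMap.comp_id]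
  -- the trace of `A` on `W` equals that of `j ∘ A ∘ p` on `T → K`, as `p ∘ j` is
  -- the identity of `W`
  rw [h1, LinearMap.trace_comp_comm', LinearMap.trace_eq_matrix_trace K (Pi.basisFun K T),
    Matrix.trace, ← Finset.sum_coe_sort T]
  refine Finset.sum_congr rfl fun i _ => ?_
  rw [Matrix.diag_apply, LinearMap.toMatrix_apply]
  simp [p, j, LinearMap.sum_apply, Pi.single_apply]

/-! ### The graded trace as a sum over sets of modes -/

/-- The projection `(1 + ε τ) / 2` onto the `ε`-eigenspace of `τ`, for `ε = ±1`. -/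
noncomputable def tauProj (ε : ℂ) : Module.End ℂ Fock := (1 / 2 : ℂ) • (1 + ε • tau)

theorem tau_comm_of_diagonal {A : Module.End ℂ Fock} {d : Finset Mode → ℂ}
    (h : ∀ S, A (fockBasis S) = d S • fockBasis S) (hd : ∀ S, d (swapSet S) = d S) (v : Fock) :
    A (tau v) = tau (A v) := by
  have : A ∘ₗ tau = tau ∘ₗ A := fockBasis.ext fun S => by
    obtain ⟨c, hc⟩ := exists_tau_fockBasis S
    simp only [LinearMap.comp_apply, h, hc, map_smul, hd]
    exact smul_comm _ _ _
  exact LinearMap.congr_fun this v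

theorem diagonal_comm {A B : Module.End ℂ Fock} {d e : Finset Mode → ℂ}
    (hA : ∀ S, A (fockBasis S) = d S • fockBasis S)
    (hB : ∀ S, B (fockBasis S) = e S • fockBasis S) (v : Fock) : A (B v) = B (A v) := by
  have : A ∘ₗ B = B ∘ₗ A := fockBasis.ext fun S => by
    simp only [LinearMap.comp_apply, hA, hB, map_smul]
    exact smul_comm _ _ _
  exact LinearMap.congr_fun this v

theorem even_degree_of_chargeOf_eq_zero {S : Finset Mode} (h : chargeOf S = 0) :
    Even (degree S) := by
  have h1 : ((degree S : ℤ) : ZMod 2) = (chargeOf S : ZMod 2) := by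
    rw [degree, chargeOf]
    push_cast
    refine Finset.sum_congr rfl fun a _ => ?_
    have h2 : (2 : ZMod 2) = 0 := rfl
    have h3 : (-1 : ZMod 2) = 1 := rfl
    cases a.1 <;> simp [h2, h3]
  rw [h] at h1
  exact (ZMod.natCast_eq_zero_iff_even).1 (by simpa using h1)

theorem mem_chargeZero_inf_eigenspace {ε : ℂ} {n : ℕ} {v : Fock} :
    v ∈ chargeZero ε ⊓ energy.eigenspace (n : ℂ) ↔
      charge v = 0 ∧ tau v = ε • v ∧ energy v = (n : ℂ) • v := by
  simp [chargeZero, and_assoc]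

theorem tauProj_of_tau_eq {ε : ℂ} (hε : ε * ε = 1) {v : Fock} (hv : tau v = ε • v) :
    tauProj ε v = v := by
  simp only [tauProj, LinearMap.smul_apply, LinearMap.add_apply, Module.End.one_apply, hv,
    smul_smul, hε]
  rw [one_smul, ← two_smul ℂ, smul_smul]
  norm_num

theorem tau_tauProj {ε : ℂ} (hε : ε * ε = 1) (v : Fock) :
    tau (tauProj ε v) = ε • tauProj ε v := by
  simp only [tauProj, LinearMap.smul_apply, LinearMap.add_apply, Module.End.one_apply, map_smul,
    map_add, tau_tau]
  have h : ε • ε • tau v = tau v := by rw [smul_smul, hε, one_smul]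
  linear_combination (norm := module) (-1 / 2 : ℂ) • h

theorem tauProj_fockBasis_mem {ε : ℂ} (hε : ε * ε = 1) {S : Finset Mode} {n : ℕ}
    (hS : chargeOf S = 0) (hn : degree S = 2 * n) :
    tauProj ε (fockBasis S) ∈ chargeZero ε ⊓ energy.eigenspace (n : ℂ) := by
  obtain ⟨c, hc⟩ := exists_tau_fockBasis S
  have e : tauProj ε (fockBasis S) =
      (1 / 2 : ℂ) • (fockBasis S + (ε * c) • fockBasis (swapSet S)) := by
    simp [tauProj, hc, smul_smul, mul_assoc]
  refine mem_chargeZero_inf_eigenspace.2 ⟨?_, tau_tauProj hε _, ?_⟩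
  · simp [e, charge_fockBasis, chargeOf_swapSet, hS]
  · have h2 : (degree S : ℂ) / 2 = n := by rw [hn]; push_cast; ring
    simp only [e, map_smul, map_add, energy_fockBasis, degree_swapSet, h2]
    module

/-- The sets of modes of charge zero and energy `n`. They lie in the first `n` modes of either
kind. -/
def zeroChargeStates (n : ℕ) : Finset (Finset Mode) :=
  (Finset.univ ×ˢ Finset.range n).powerset.filter fun S => chargeOf S = 0 ∧ degree S = 2 * n

theorem mem_zeroChargeStates {n : ℕ} {S : Finset Mode} :
    S ∈ zeroChargeStates n ↔ chargeOf S = 0 ∧ degree S = 2 * n := by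
  rw [zeroChargeStates, Finset.mem_filter, and_iff_right_iff_imp]
  rintro ⟨-, h⟩
  rw [Finset.mem_powerset]
  intro a ha
  have h1 : 2 * a.2 + 1 ≤ degree S :=
    Finset.single_le_sum (f := fun a : Mode => 2 * a.2 + 1) (fun _ _ => Nat.zero_le _) ha
  simp only [Finset.mem_product, Finset.mem_univ, Finset.mem_range, true_and]
  omega

/-- The graded trace of `D(t)` on the `ε`-eigenspace of `τ` in charge zero, as a sum over sets of
modes. The degree of a set of charge zero is even, so that its half is the energy. -/
theorem hasQTrace_of_hasSum {q u ε z : ℂ} (hε : ε = 1 ∨ ε = -1)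
    (h : HasSum (fun S : Finset Mode => if chargeOf S = 0 then
      q ^ (degree S / 2) * (eigD u S * (1 / 2 * (1 + ε * tauCoeff S))) else 0) z) :
    HasQTrace q (D u) (chargeZero ε) z := by
  have hε2 : ε * ε = 1 := by rcases hε with rfl | rfl <;> norm_num
  have hD := D_fockBasis u
  have hT (n : ℕ) : ∀ w ∈ chargeZero ε ⊓ energy.eigenspace (n : ℂ),
      ∀ S ∉ zeroChargeStates n, fockBasis.repr w S = 0 := by
    intro w hw S hS
    obtain ⟨h1, -, h3⟩ := mem_chargeZero_inf_eigenspace.1 hw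
    have h4 := repr_of_diagonal charge_fockBasis w S
    have h5 := repr_of_diagonal energy_fockBasis w S
    rw [h1] at h4
    rw [h3] at h5
    simp only [map_smul, Finsupp.smul_apply, smul_eq_mul, map_zero, Finsupp.zero_apply] at h4 h5
    by_contra hne
    refine hS (mem_zeroChargeStates.2 ⟨?_, ?_⟩)
    · exact_mod_cast (mul_eq_zero.1 h4.symm).resolve_right hne
    · have h6 : (n : ℂ) = degree S / 2 := mul_right_cancel₀ hne h5
      have h7 : (degree S : ℂ) = ((2 * n : ℕ) : ℂ) := by push_cast; rw [h6]; ring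
      exact_mod_cast h7
  have htr (n : ℕ) := trace_restrict_of_basis fockBasis (zeroChargeStates n)
    (chargeZero ε ⊓ energy.eigenspace (n : ℂ)) (tauProj ε) (D u)
    (fun w hw => tauProj_of_tau_eq hε2 (mem_chargeZero_inf_eigenspace.1 hw).2.1)
    (fun S hS => tauProj_fockBasis_mem hε2 (mem_zeroChargeStates.1 hS).1
      (mem_zeroChargeStates.1 hS).2) (hT n)
  have hstable (n : ℕ) : ∀ v ∈ chargeZero ε ⊓ energy.eigenspace (n : ℂ),
      D u v ∈ chargeZero ε ⊓ energy.eigenspace (n : ℂ) := by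
    intro v hv
    obtain ⟨h1, h2, h3⟩ := mem_chargeZero_inf_eigenspace.1 hv
    refine mem_chargeZero_inf_eigenspace.2 ⟨?_, ?_, ?_⟩
    · rw [← diagonal_comm hD charge_fockBasis, h1, map_zero]
    · rw [← tau_comm_of_diagonal hD (eigD_swapSet u), h2, map_smul]
    · rw [← diagonal_comm hD energy_fockBasis, h3, map_smul]
  refine ⟨le_antisymm ?_ (iSup_le fun n => inf_le_left), fun n => (htr n).1, hstable, ?_⟩
  · intro v hv
    have hv' : charge v = 0 ∧ tau v = ε • v := by
      simpa [chargeZero, Module.End.mem_eigenspace_iff] using hv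
    rw [← tauProj_of_tau_eq hε2 hv'.2, ← fockBasis.linearCombination_repr v,
      Finsupp.linearCombination_apply, Finsupp.sum, map_sum]
    refine Submodule.sum_mem _ fun S hS => ?_
    rw [map_smul]
    refine Submodule.smul_mem _ _ ?_
    have h4 := repr_of_diagonal charge_fockBasis v S
    rw [hv'.1] at h4
    have h5 : chargeOf S = 0 := by
      simpa [Finsupp.mem_support_iff.1 hS] using h4
    obtain ⟨n, hn⟩ := even_degree_of_chargeOf_eq_zero h5
    exact Submodule.mem_iSup_of_mem n (tauProj_fockBasis_mem hε2 h5 (by omega))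
  · convert! h.tsum_fiberwise (fun S => degree S / 2) using 2 with n
    rw [(htr n).2 (hstable n), Finset.mul_sum, tsum_subtype ((fun S => degree S / 2) ⁻¹' {n})
      (fun S : Finset Mode => if chargeOf S = 0 then
      q ^ (degree S / 2) * (eigD u S * (1 / 2 * (1 + ε * tauCoeff S))) else 0),
      tsum_eq_sum (s := zeroChargeStates n)]
    · refine Finset.sum_congr rfl fun S hS => ?_
      obtain ⟨h1, h2⟩ := mem_zeroChargeStates.1 hS
      have h3 : degree S / 2 = n := by omega
      rw [Set.indicator_of_mem (by simpa using h3), if_pos h1, h3, repr_of_diagonal hD]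
      simp [tauProj, repr_tau_fockBasis]
      ring_nf
      simp
    · intro S hS
      rw [Set.indicator_apply_eq_zero]
      intro h1
      rw [if_neg]
      intro h2
      obtain ⟨k, hk⟩ := even_degree_of_chargeOf_eq_zero h2
      refine hS (mem_zeroChargeStates.2 ⟨h2, ?_⟩)
      have h3 : degree S / 2 = n := h1
      omega

/-! ### Sums over finite sets with a marked element -/

section FinsetSums

variable {ι : Type*} [DecidableEq ι]

/-- Adding an element to a finite set that does not contain it, and removing it otherwise. -/
def toggle (a : ι) : Equiv.Perm (Finset ι) :=
  Function.Involutive.toPerm (fun S => if a ∈ S then S.erase a else insert a S) fun S => by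
    by_cases h : a ∈ S <;> simp [h]

theorem toggle_of_mem {a : ι} {S : Finset ι} (h : a ∈ S) : toggle a S = S.erase a := if_pos h

theorem toggle_of_notMem {a : ι} {S : Finset ι} (h : a ∉ S) : toggle a S = insert a S := if_neg h

/-- Removing the marked element `a` from the sets containing it. No summability is needed, since
this is a bijection of the index sets. -/
theorem tsum_mem_eq (f : ι → ℂ) (h : Finset ι → ℂ) (a : ι) :
    ∑' S : Finset ι, (if a ∈ S then h S * ∏ i ∈ S, f i else 0) =
      f a * ∑' S : Finset ι, (if a ∈ S then 0 else h (insert a S) * ∏ i ∈ S, f i) := by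
  rw [← tsum_mul_left, ← (toggle a).tsum_eq]
  refine tsum_congr fun S => ?_
  by_cases hS : a ∈ S
  · simp [toggle_of_mem hS, hS]
  · rw [toggle_of_notMem hS, if_pos (Finset.mem_insert_self a S), if_neg hS,
      Finset.prod_insert hS]
    ring

theorem summable_mem_mul_prod {f w : ι → ℂ} {h : Finset ι → ℂ} (hf : Summable fun a => ‖f a‖)
    (hwf : Summable fun a => ‖w a * f a‖) (hh : ∀ S, ‖h S‖ ≤ 1) :
    Summable fun x : ι × Finset ι =>
      if x.1 ∈ x.2 then w x.1 * (h x.2 * ∏ i ∈ x.2, f i) else 0 := by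
  have hP : Summable fun S : Finset ι => ∏ i ∈ S, ‖f i‖ :=
    summable_finsetProd_of_summable_nonneg (fun _ => norm_nonneg _) hf
  have hG : Summable fun x : ι × Finset ι => ‖w x.1 * f x.1‖ * ∏ i ∈ x.2, ‖f i‖ :=
    hwf.mul_of_nonneg hP (fun _ => norm_nonneg _) fun _ =>
      Finset.prod_nonneg fun _ _ => norm_nonneg _
  let e : ι × Finset ι → ι × Finset ι := fun x => (x.1, toggle x.1 x.2)
  have he : Function.Injective e := by
    rintro ⟨a, S⟩ ⟨b, T⟩ hab
    obtain ⟨rfl, h2⟩ := Prod.mk.inj hab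
    exact Prod.ext rfl ((toggle a).injective h2)
  refine (hG.comp_injective he).of_norm_bounded fun x => ?_
  obtain ⟨a, S⟩ := x
  by_cases hx : a ∈ S
  · simp only [Function.comp_apply, e, toggle_of_mem hx, if_pos hx]
    rw [← Finset.mul_prod_erase _ _ hx, norm_mul, norm_mul, norm_mul, norm_mul]
    calc _ ≤ ‖w a‖ * (1 * (‖f a‖ * ∏ i ∈ S.erase a, ‖f i‖)) := by
          gcongr
          · exact hh _
          · exact Finset.norm_prod_le _ _
      _ = _ := by ring
  · simp only [if_neg hx, norm_zero]
    exact mul_nonneg (norm_nonneg _) (Finset.prod_nonneg fun _ _ => norm_nonneg _)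

/-- Sums over finite sets weighted by an additive statistic, with the roles of the set and of the
marked element exchanged. -/
theorem hasSum_prod_mul_sum {f w : ι → ℂ} {h : Finset ι → ℂ} (hf : Summable fun a => ‖f a‖)
    (hwf : Summable fun a => ‖w a * f a‖) (hh : ∀ S, ‖h S‖ ≤ 1) :
    HasSum (fun S : Finset ι => (h S * ∏ i ∈ S, f i) * ∑ a ∈ S, w a)
      (∑' a, w a * ∑' S : Finset ι, if a ∈ S then h S * ∏ i ∈ S, f i else 0) := by
  obtain ⟨F, hFdef⟩ : ∃ F : ι × Finset ι → ℂ, F = fun x =>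
    if x.1 ∈ x.2 then w x.1 * (h x.2 * ∏ i ∈ x.2, f i) else 0 := ⟨_, rfl⟩
  have hF : Summable F := hFdef ▸ summable_mem_mul_prod hf hwf hh
  have h1 : HasSum (fun x : Finset ι × ι => F (x.2, x.1)) (∑' x, F x) :=
    (Equiv.prodComm (Finset ι) ι).hasSum_iff.2 hF.hasSum
  have h3 (S : Finset ι) : HasSum (fun a => F (a, S)) ((h S * ∏ i ∈ S, f i) * ∑ a ∈ S, w a) := by
    have h4 : ∑ a ∈ S, F (a, S) = (h S * ∏ i ∈ S, f i) * ∑ a ∈ S, w a := by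
      rw [Finset.mul_sum]
      refine Finset.sum_congr rfl fun a ha => ?_
      simp only [hFdef, if_pos ha]
      ring
    rw [← h4]
    exact hasSum_sum_of_ne_finset_zero fun a ha => by rw [hFdef]; exact if_neg ha
  have h2 := h1.prod_fiberwise h3
  have h5 : ∑' x, F x = ∑' a, w a * ∑' S : Finset ι, if a ∈ S then h S * ∏ i ∈ S, f i else 0 := by
    rw [hF.tsum_prod' fun a => hF.comp_injective (Prod.mk_right_injective a)]
    refine tsum_congr fun a => ?_
    rw [← tsum_mul_left]
    refine tsum_congr fun S => ?_
    simp only [hFdef, mul_ite, mul_zero]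
  rwa [h5] at h2

end FinsetSums

/-- Unfolding the recursion `N k = x (Z (k+1) - N (k+1))` indefinitely. -/
theorem hasSum_of_alternating_recursion {x : ℂ} {N Z : ℕ → ℂ} {C : ℝ} (hx : ‖x‖ < 1)
    (hN : ∀ k, N k = x * (Z (k + 1) - N (k + 1))) (hNC : ∀ k, ‖N k‖ ≤ C)
    (hZC : ∀ k, ‖Z k‖ ≤ C) :
    HasSum (fun j : ℕ => (-1) ^ j * x ^ (j + 1) * Z (j + 1)) (N 0) := by
  have hs : Summable fun j : ℕ => (-1) ^ j * x ^ (j + 1) * Z (j + 1) := by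
    refine ((summable_geometric_of_lt_one (norm_nonneg x) hx).mul_right C).of_norm_bounded
      fun j => ?_
    rw [norm_mul, norm_mul, norm_pow, norm_pow, norm_neg, norm_one, one_pow, one_mul, pow_succ]
    have := hZC (j + 1)
    have h1 : ‖x‖ ^ j * ‖x‖ ≤ ‖x‖ ^ j := mul_le_of_le_one_right (by positivity) hx.le
    gcongr
  have hpart (n : ℕ) : ∑ j ∈ Finset.range n, (-1) ^ j * x ^ (j + 1) * Z (j + 1) =
      N 0 - (-1) ^ n * x ^ n * N n := by
    induction n with
    | zero => simp
    | succ n ih =>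
      rw [Finset.sum_range_succ, ih, hN n]
      ring
  have hlim : Tendsto (fun n : ℕ => (-1) ^ n * x ^ n * N n) atTop (𝓝 0) := by
    have h1 : Tendsto (fun n : ℕ => ‖x‖ ^ n * C) atTop (𝓝 0) := by
      simpa using (tendsto_pow_atTop_nhds_zero_of_lt_one (norm_nonneg x) hx).mul_const C
    refine squeeze_zero_norm (fun n => ?_) h1
    rw [norm_mul, norm_mul, norm_pow, norm_pow, norm_neg, norm_one, one_pow, one_mul]
    have := hNC n
    gcongr
  have h2 : Tendsto (fun n : ℕ => N 0 - (-1) ^ n * x ^ n * N n) atTop (𝓝 (N 0)) := by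
    simpa using hlim.const_sub (N 0)
  have h3 := hs.hasSum.tendsto_sum_nat
  simp only [hpart] at h3
  rw [← tendsto_nhds_unique h3 h2]
  exact hs.hasSum

/-! ### Gaussian binomials and the charge of sets in a finite box -/

/-- The Gaussian binomial coefficient. -/
noncomputable def qBinom (q : ℂ) (n k : ℕ) : ℂ :=
  if k ≤ n then qFact q n / (qFact q k * qFact q (n - k)) else 0

theorem qBinom_zero {q : ℂ} (hq : ‖q‖ < 1) (n : ℕ) : qBinom q n 0 = 1 := by
  simp [qBinom, qFact_zero, div_self (qFact_ne_zero hq n)]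

theorem qBinom_of_lt {q : ℂ} {n k : ℕ} (h : n < k) : qBinom q n k = 0 := if_neg (by omega)

theorem qBinom_add {q : ℂ} (k l : ℕ) :
    qBinom q (k + l) k = qFact q (k + l) / (qFact q k * qFact q l) := by
  rw [qBinom, if_pos (by omega), Nat.add_sub_cancel_left]

theorem qBinom_succ_succ {q : ℂ} (hq : ‖q‖ < 1) {n k : ℕ} (h : k ≤ n) :
    qBinom q (n + 1) (k + 1) = qBinom q n (k + 1) + q ^ (n - k) * qBinom q n k := by
  obtain ⟨l, rfl⟩ := Nat.exists_eq_add_of_le h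
  have e : k + l + 1 = (k + 1) + l := by omega
  rw [Nat.add_sub_cancel_left, e, qBinom_add, qBinom_add]
  have h1 := qFact_ne_zero hq k
  have h2 := one_sub_pow_succ_ne_zero hq k
  cases l with
  | zero =>
    have h3 := qFact_ne_zero hq (k + 1)
    rw [qBinom_of_lt (by omega)]
    simp [qFact_zero, h1, h3]
  | succ l =>
    have e1 : k + (l + 1) = (k + 1) + l := by omega
    have e2 : k + 1 + (l + 1) = (k + 1 + l) + 1 := by omega
    have h3 := qFact_ne_zero hq l
    have h4 := one_sub_pow_succ_ne_zero hq l
    rw [e1, qBinom_add, e2, qFact_succ _ (k + 1 + l), qFact_succ _ k, qFact_succ _ l]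
    field_simp
    ring

theorem qBinom_succ_succ' {q : ℂ} (hq : ‖q‖ < 1) (n k : ℕ) :
    qBinom q (n + 1) (k + 1) = qBinom q n k + q ^ (k + 1) * qBinom q n (k + 1) := by
  rcases lt_or_ge n k with h | h
  · rw [qBinom_of_lt h, qBinom_of_lt (by omega), qBinom_of_lt (by omega)]; simp
  obtain ⟨l, rfl⟩ := Nat.exists_eq_add_of_le h
  have e : k + l + 1 = (k + 1) + l := by omega
  rw [e, qBinom_add, qBinom_add]
  have h1 := qFact_ne_zero hq k
  have h2 := one_sub_pow_succ_ne_zero hq k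
  cases l with
  | zero =>
    have h3 := qFact_ne_zero hq (k + 1)
    rw [qBinom_of_lt (by omega)]
    simp [qFact_zero, h1, h3]
  | succ l =>
    have e1 : k + (l + 1) = (k + 1) + l := by omega
    have e2 : k + 1 + (l + 1) = (k + 1 + l) + 1 := by omega
    have h3 := qFact_ne_zero hq l
    have h4 := one_sub_pow_succ_ne_zero hq l
    rw [e1, qBinom_add, e2, qFact_succ _ (k + 1 + l), qFact_succ _ k, qFact_succ _ l]
    field_simp
    ring

/-- The charge of a single mode. -/
def modeCharge (a : Mode) : ℤ := if a.1 then 1 else -1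

theorem chargeOf_insert {a : Mode} {S : Finset Mode} (h : a ∉ S) :
    chargeOf (insert a S) = modeCharge a + chargeOf S := Finset.sum_insert h

theorem degree_insert {a : Mode} {S : Finset Mode} (h : a ∉ S) :
    degree (insert a S) = 2 * a.2 + 1 + degree S := Finset.sum_insert h

/-- The sum of `p ^ degree S` over the `S ⊆ B` of charge `c`. -/
noncomputable def finChargeSum (p : ℂ) (B : Finset Mode) (c : ℤ) : ℂ :=
  ∑ S ∈ B.powerset, if chargeOf S = c then p ^ degree S else 0

theorem finChargeSum_insert (p : ℂ) {B : Finset Mode} {a : Mode} (h : a ∉ B) (c : ℤ) :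
    finChargeSum p (insert a B) c =
      finChargeSum p B c + p ^ (2 * a.2 + 1) * finChargeSum p B (c - modeCharge a) := by
  rw [finChargeSum, Finset.sum_powerset_insert h, finChargeSum, finChargeSum, Finset.mul_sum]
  congr 1
  refine Finset.sum_congr rfl fun S hS => ?_
  have ha : a ∉ S := fun hS' => h (Finset.mem_powerset.1 hS hS')
  rw [chargeOf_insert ha, degree_insert ha, pow_add, mul_ite, mul_zero]
  exact if_congr (by constructor <;> intro h <;> linarith) rfl rfl

/-- The modes `ψ^±_{-1/2}, …, ψ^±_{-(n-1/2)}`. -/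
def box (n : ℕ) : Finset Mode := Finset.univ ×ˢ Finset.range n

theorem box_succ (n : ℕ) : box (n + 1) = insert (false, n) (insert (true, n) (box n)) := by
  ext ⟨_ | _, m⟩ <;> simp [box] <;> omega

/-- The generating function after one more mode `ψ⁺` is added to the box; this is the first Pascal
rule. -/
theorem finChargeSum_insert_box {p : ℂ} (hp : ‖p ^ 2‖ < 1) {n : ℕ}
    (h : ∀ c : ℤ, finChargeSum p (box n) c = if 0 ≤ n + c then
      p ^ (c.natAbs ^ 2) * qBinom (p ^ 2) (2 * n) (n + c).toNat else 0) (c : ℤ) :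
    finChargeSum p (insert (true, n) (box n)) c = if 0 ≤ n + c then
      p ^ (c.natAbs ^ 2) * qBinom (p ^ 2) (2 * n + 1) (n + c).toNat else 0 := by
  rw [finChargeSum_insert p (by simp [box]), h, h]
  have e0 : modeCharge (true, n) = 1 := rfl
  rw [e0]
  rcases lt_trichotomy (n + c) 0 with hc | hc | hc
  · rw [if_neg (by omega), if_neg (by omega), if_neg (by omega)]; simp
  · rw [if_pos (by omega), if_neg (by omega), if_pos (by omega), hc]
    simp [qBinom_zero hp]
  · obtain ⟨K, hK⟩ := Int.eq_ofNat_of_zero_le (show 0 ≤ n + c - 1 by omega)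
    rw [if_pos (by omega), if_pos (by omega), if_pos (by omega)]
    have e1 : (n + c).toNat = K + 1 := by omega
    have e2 : (n + (c - 1)).toNat = K := by omega
    rw [e1, e2]
    rcases lt_or_ge (2 * n) K with h3 | h3
    · rw [qBinom_of_lt (by omega), qBinom_of_lt (by omega), qBinom_of_lt (by omega)]; simp
    · rw [qBinom_succ_succ hp h3, mul_add, ← mul_assoc, ← mul_assoc]
      congr 2
      rw [← pow_mul, ← pow_add, ← pow_add]
      congr 1
      zify [h3]
      rw [sq_abs, sq_abs]
      have : c = K + 1 - n := by omega
      rw [this]; ring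

/-- Finite form of the Jacobi triple product identity, coefficientwise: the sets of charge `c` in
the box have generating function `p^{c²} [2n; n + c]`. -/
theorem finChargeSum_box {p : ℂ} (hp : ‖p ^ 2‖ < 1) (n : ℕ) (c : ℤ) :
    finChargeSum p (box n) c = if 0 ≤ n + c then
      p ^ (c.natAbs ^ 2) * qBinom (p ^ 2) (2 * n) (n + c).toNat else 0 := by
  induction n generalizing c with
  | zero =>
    have e : box 0 = ∅ := by simp [box]
    rw [e, finChargeSum]
    simp only [Finset.powerset_empty, Finset.sum_singleton]
    have e2 : chargeOf ∅ = 0 := rfl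
    have e3 : degree ∅ = 0 := rfl
    rw [e2, e3, Nat.cast_zero, zero_add]
    rcases lt_trichotomy c 0 with hc | hc | hc
    · rw [if_neg (by omega), if_neg (by omega)]
    · subst hc; simp [qBinom_zero hp]
    · rw [if_neg (by omega), if_pos (by omega), qBinom_of_lt (by omega), mul_zero]
  | succ n ih =>
    have ih' := finChargeSum_insert_box hp ih
    rw [box_succ, finChargeSum_insert p (by simp [box]), ih', ih']
    have e0 : modeCharge (false, n) = -1 := rfl
    rw [e0, sub_neg_eq_add]
    push_cast
    rcases lt_trichotomy (n + 1 + c) 0 with hc | hc | hc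
    · rw [if_neg (by omega), if_neg (by omega), if_neg (by omega)]; simp
    · rw [if_neg (by omega), if_pos (by omega), if_pos (by omega)]
      have e1 : (n + (c + 1)).toNat = 0 := by omega
      have e2 : (n + 1 + c).toNat = 0 := by omega
      rw [e1, e2, qBinom_zero hp, qBinom_zero hp, mul_one, mul_one, zero_add, ← pow_add]
      congr 1
      zify
      rw [sq_abs, sq_abs]
      have : c = -1 - n := by omega
      rw [this]; ring
    · obtain ⟨K, hK⟩ := Int.eq_ofNat_of_zero_le (show 0 ≤ n + c by omega)
      rw [if_pos (by omega), if_pos (by omega), if_pos (by omega)]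
      have e1 : (n + c).toNat = K := by omega
      have e2 : (n + (c + 1)).toNat = K + 1 := by omega
      have e3 : (n + 1 + c).toNat = K + 1 := by omega
      have e4 : 2 * (n + 1) = (2 * n + 1) + 1 := by ring
      rw [e1, e2, e3, e4, qBinom_succ_succ' hp (2 * n + 1) K, mul_add, ← mul_assoc, ← mul_assoc]
      congr 2
      rw [← pow_mul, ← pow_add, ← pow_add]
      congr 1
      zify
      rw [sq_abs, sq_abs]
      have : c = K - n := by omega
      rw [this]; ring

/-! ### Generating functions of sets of fixed charge -/

theorem prod_pow_eq_pow_degree (x : ℂ) (S : Finset Mode) :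
    ∏ a ∈ S, x ^ (2 * a.2 + 1) = x ^ degree S := Finset.prod_pow_eq_pow_sum _ _ _

theorem summable_bool_prod {g : ℕ → ℝ} (hg : Summable g) (hg0 : ∀ n, 0 ≤ g n) :
    Summable fun a : Mode => g a.2 := by
  have h := (Summable.of_finite (f := fun _ : Bool => (1 : ℝ))).mul_of_nonneg hg
    (fun _ => zero_le_one) hg0
  simpa using h

theorem summable_pow_odd {r : ℝ} (h0 : 0 ≤ r) (h1 : r < 1) :
    Summable fun m : ℕ => r ^ (2 * m + 1) := by
  refine (summable_geometric_of_lt_one h0 h1).of_nonneg_of_le (fun m => by positivity) fun m => ?_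
  exact pow_le_pow_of_le_one h0 h1.le (by omega)

theorem summable_mode_weight {p : ℂ} (hp : ‖p‖ < 1) :
    Summable fun a : Mode => ‖p ^ (2 * a.2 + 1)‖ := by
  simp only [norm_pow]
  exact summable_bool_prod (summable_pow_odd (norm_nonneg p) hp) fun _ => by positivity

theorem summable_norm_pow_degree {p : ℂ} (hp : ‖p‖ < 1) :
    Summable fun S : Finset Mode => ‖p ^ degree S‖ := by
  have h := summable_finsetProd_of_summable_nonneg (fun _ => norm_nonneg _)
    (summable_mode_weight hp)
  refine h.congr fun S => ?_
  rw [← norm_prod, prod_pow_eq_pow_degree]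

theorem summable_ite_pow_degree {p : ℂ} (hp : ‖p‖ < 1) (P : Finset Mode → Prop)
    [DecidablePred P] : Summable fun S : Finset Mode => if P S then p ^ degree S else 0 := by
  refine (summable_norm_pow_degree hp).of_norm_bounded fun S => ?_
  split_ifs <;> simp

/-- The sum of `p ^ degree S` over all `S` of charge `c`. -/
noncomputable def chargeSum (p : ℂ) (c : ℤ) : ℂ :=
  ∑' S : Finset Mode, if chargeOf S = c then p ^ degree S else 0

theorem box_mono : Monotone box := fun _ _ h => Finset.product_subset_product_right
  (Finset.range_subset_range.2 h)

theorem tendsto_finChargeSum {p : ℂ} (hp : ‖p‖ < 1) (c : ℤ) :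
    Tendsto (fun n => finChargeSum p (box n) c) atTop (𝓝 (chargeSum p c)) := by
  have h := (summable_ite_pow_degree hp fun S => chargeOf S = c).hasSum
  have hbox : Tendsto box atTop atTop :=
    tendsto_atTop_finset_of_monotone box_mono fun a => ⟨a.2 + 1, by simp [box]⟩
  exact (h.comp tendsto_finset_powerset_atTop_atTop).comp hbox

/-- The Jacobi triple product identity, coefficientwise. -/
theorem chargeSum_eq {p : ℂ} (hp : ‖p‖ < 1) (c : ℤ) :
    chargeSum p c = p ^ (c.natAbs ^ 2) / qPoch (p ^ 2) (p ^ 2) := by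
  have hq := norm_sq_lt_one hp
  have h0 := qPoch_self_ne_zero hq
  have h := tendsto_qFact hq
  have h1 : Tendsto (fun n : ℕ => 2 * n) atTop atTop :=
    tendsto_atTop_mono (fun n => Nat.le_mul_of_pos_left n two_pos) tendsto_id
  have h2 : Tendsto (fun n : ℕ => (n + c).toNat) atTop atTop :=
    tendsto_atTop_atTop.2 fun b => ⟨b + c.natAbs, fun n hn => by omega⟩
  have h3 : Tendsto (fun n : ℕ => 2 * n - (n + c).toNat) atTop atTop :=
    tendsto_atTop_atTop.2 fun b => ⟨b + c.natAbs, fun n hn => by omega⟩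
  have h4 := ((h.comp h1).div ((h.comp h2).mul (h.comp h3)) (mul_ne_zero h0 h0)).const_mul
    (p ^ (c.natAbs ^ 2))
  have h5 : p ^ (c.natAbs ^ 2) * (qPoch (p ^ 2) (p ^ 2) /
      (qPoch (p ^ 2) (p ^ 2) * qPoch (p ^ 2) (p ^ 2))) =
      p ^ (c.natAbs ^ 2) / qPoch (p ^ 2) (p ^ 2) := by
    field_simp
  rw [h5] at h4
  refine tendsto_nhds_unique (tendsto_finChargeSum hp c) (h4.congr' ?_)
  filter_upwards [eventually_ge_atTop c.natAbs] with n hn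
  rw [finChargeSum_box hq, if_pos (by omega), qBinom, if_pos (by omega)]
  rfl

/-- The sum of `p ^ degree S` over all `S` of charge `c` in which the mode `a` is occupied. -/
noncomputable def occupiedSum (p : ℂ) (a : Mode) (c : ℤ) : ℂ :=
  ∑' S : Finset Mode, if a ∈ S then (if chargeOf S = c then 1 else 0) * p ^ degree S else 0

/-- Emptying the mode `a` leads to the sets of charge `c - modeCharge a` without `a`. -/
theorem occupiedSum_eq {p : ℂ} (hp : ‖p‖ < 1) (a : Mode) (c : ℤ) :
    occupiedSum p a c = p ^ (2 * a.2 + 1) *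
      (chargeSum p (c - modeCharge a) - occupiedSum p a (c - modeCharge a)) := by
  have h := tsum_mem_eq (fun a : Mode => p ^ (2 * a.2 + 1))
    (fun S => if chargeOf S = c then 1 else 0) a
  simp only [prod_pow_eq_pow_degree] at h
  rw [occupiedSum, h]
  congr 1
  have hs : Summable fun S : Finset Mode => if a ∈ S then
      (if chargeOf S = c - modeCharge a then 1 else 0) * p ^ degree S else 0 := by
    refine (summable_ite_pow_degree hp
      fun S => a ∈ S ∧ chargeOf S = c - modeCharge a).congr fun S => ?_
    by_cases h1 : a ∈ S <;> by_cases h2 : chargeOf S = c - modeCharge a <;> simp [h1, h2]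
  rw [chargeSum, occupiedSum, ← (summable_ite_pow_degree hp _).tsum_sub hs]
  refine tsum_congr fun S => ?_
  by_cases h1 : a ∈ S
  · by_cases h2 : chargeOf S = c - modeCharge a <;> simp [h1, h2]
  · rw [if_neg h1, if_neg h1, sub_zero, chargeOf_insert h1]
    by_cases h2 : chargeOf S = c - modeCharge a
    · rw [if_pos (by omega), if_pos h2, one_mul]
    · rw [if_neg (by omega), if_neg h2, zero_mul]

/-- The generating function of the sets of charge zero in which the mode `a` is occupied. The
recursion `occupiedSum_eq` runs through the charges `-1, -2, …` for a mode `ψ⁺` and `1, 2, …` for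
a mode `ψ⁻`, and `chargeSum` is even in the charge. -/
theorem hasSum_occupiedSum {p : ℂ} (hp : ‖p‖ < 1) (a : Mode) :
    HasSum (fun j : ℕ => (-1) ^ j * (p ^ (2 * a.2 + 1)) ^ (j + 1) *
      (p ^ ((j + 1) ^ 2) / qPoch (p ^ 2) (p ^ 2))) (occupiedSum p a 0) := by
  have hx : ‖p ^ (2 * a.2 + 1)‖ < 1 := by
    rw [norm_pow]; exact pow_lt_one₀ (norm_nonneg _) hp (by omega)
  have habs (k : ℕ) : (-modeCharge a * k).natAbs = k := by
    rw [Int.natAbs_mul]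
    rcases a with ⟨_ | _, m⟩ <;> simp [modeCharge]
  have hbound (g : Finset Mode → ℂ) (hg : ∀ S, ‖g S‖ ≤ ‖p ^ degree S‖) :
      ‖∑' S, g S‖ ≤ ∑' S : Finset Mode, ‖p ^ degree S‖ :=
    tsum_of_norm_bounded (summable_norm_pow_degree hp).hasSum hg
  have h := hasSum_of_alternating_recursion (x := p ^ (2 * a.2 + 1))
    (N := fun k : ℕ => occupiedSum p a (-modeCharge a * k))
    (Z := fun k : ℕ => chargeSum p (-modeCharge a * k))
    (C := ∑' S : Finset Mode, ‖p ^ degree S‖) hx (fun k => ?_)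
    (fun k => hbound _ fun S => ?_) (fun k => hbound _ fun S => ?_)
  · simp only [chargeSum_eq hp, habs, Nat.cast_zero, mul_zero] at h
    exact h
  · have e : -modeCharge a * (k : ℤ) - modeCharge a = -modeCharge a * ((k + 1 : ℕ) : ℤ) := by
      push_cast; ring
    rw [occupiedSum_eq hp, e]
  · split_ifs <;> simp
  · split_ifs <;> simp

/-! ### The contribution of the identity -/

/-- The closed form of `∑_{m ≥ 0} (u^{2m+1} - u^{-2m-1}) x^{2m+1}`. -/
noncomputable def oddGeom (u x : ℂ) : ℂ :=
  x * u / (1 - x ^ 2 * u ^ 2) - x * u⁻¹ / (1 - x ^ 2 * (u ^ 2)⁻¹)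

theorem hasSum_oddGeom {u x : ℂ} (h1 : ‖x * u‖ < 1) (h2 : ‖x * u⁻¹‖ < 1) :
    HasSum (fun m : ℕ => (u ^ (2 * m + 1) - (u ^ (2 * m + 1))⁻¹) * x ^ (2 * m + 1))
      (oddGeom u x) := by
  have key (z : ℂ) (hz : ‖z‖ < 1) : HasSum (fun m : ℕ => z ^ (2 * m + 1)) (z / (1 - z ^ 2)) := by
    have := (hasSum_geometric_of_norm_lt_one (norm_sq_lt_one hz)).mul_left z
    rw [← div_eq_mul_inv] at this
    refine this.congr_fun fun m => ?_
    ring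
  have := (key _ h1).sub (key _ h2)
  rw [mul_pow, mul_pow, inv_pow] at this
  refine this.congr_fun fun m => ?_
  rw [mul_pow, mul_pow, inv_pow]
  ring

theorem norm_pow_succ_mul_lt_one {y u : ℂ} (h0 : ‖y‖ < 1) (h : ‖y * u‖ < 1) (j : ℕ) :
    ‖y ^ (j + 1) * u‖ < 1 := by
  rw [pow_succ, mul_assoc, norm_mul, norm_pow]
  exact (mul_le_of_le_one_left (norm_nonneg _) (pow_le_one₀ (norm_nonneg _) h0.le)).trans_lt h

theorem summable_oddWeight {u x : ℂ} (h1 : ‖x * u‖ < 1) (h2 : ‖x * u⁻¹‖ < 1) :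
    Summable fun m : ℕ => ‖(u ^ (2 * m + 1) - (u ^ (2 * m + 1))⁻¹) * x ^ (2 * m + 1)‖ := by
  refine ((summable_pow_odd (norm_nonneg _) h1).add
    (summable_pow_odd (norm_nonneg _) h2)).of_nonneg_of_le (fun _ => norm_nonneg _) fun m => ?_
  have e : (u ^ (2 * m + 1) - (u ^ (2 * m + 1))⁻¹) * x ^ (2 * m + 1) =
      (x * u) ^ (2 * m + 1) - (x * u⁻¹) ^ (2 * m + 1) := by
    rw [mul_pow, mul_pow, inv_pow]; ring
  rw [e]
  refine (norm_sub_le _ _).trans ?_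
  rw [norm_pow, norm_pow]

/-- Summation over the modes `m` first, in a double series with the weights `u^{2m+1} -
u^{-2m-1}`. -/
theorem tsum_oddWeight_mul_tsum {u y : ℂ} {κ : ℕ → ℂ} {C : ℝ} (hy : ‖y‖ < 1) (h1 : ‖y * u‖ < 1)
    (h2 : ‖y * u⁻¹‖ < 1) (hκ : ∀ j, ‖κ j‖ ≤ C) :
    (Summable fun m : ℕ => (u ^ (2 * m + 1) - (u ^ (2 * m + 1))⁻¹) *
        ∑' j : ℕ, κ j * (y ^ (2 * m + 1)) ^ (j + 1)) ∧
    HasSum (fun j : ℕ => κ j * oddGeom u (y ^ (j + 1)))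
      (∑' m : ℕ, (u ^ (2 * m + 1) - (u ^ (2 * m + 1))⁻¹) *
        ∑' j : ℕ, κ j * (y ^ (2 * m + 1)) ^ (j + 1)) := by
  obtain ⟨G, hG⟩ : ∃ G : ℕ × ℕ → ℂ, G = fun x => (u ^ (2 * x.1 + 1) - (u ^ (2 * x.1 + 1))⁻¹) *
    (κ x.2 * (y ^ (2 * x.1 + 1)) ^ (x.2 + 1)) := ⟨_, rfl⟩
  have hs : Summable G := by
    refine ((summable_oddWeight h1 h2).mul_of_nonneg
      ((summable_geometric_of_lt_one (norm_nonneg y) hy).mul_right C) (fun _ => norm_nonneg _)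
      fun j => mul_nonneg (by positivity) ((norm_nonneg _).trans (hκ 0))).of_norm_bounded
      fun x => ?_
    have e : G x = (u ^ (2 * x.1 + 1) - (u ^ (2 * x.1 + 1))⁻¹) * y ^ (2 * x.1 + 1) *
        ((y ^ x.2) ^ (2 * x.1 + 1) * κ x.2) := by
      simp only [hG]
      rw [pow_succ (y ^ (2 * x.1 + 1)), ← pow_mul, ← pow_mul, mul_comm (2 * x.1 + 1)]
      ring
    have h3 := hκ x.2
    have h4 : ‖(y ^ x.2) ^ (2 * x.1 + 1)‖ ≤ ‖y‖ ^ x.2 := by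
      rw [norm_pow, norm_pow]
      exact pow_le_of_le_one (by positivity) (pow_le_one₀ (norm_nonneg _) hy.le) (by omega)
    rw [e, norm_mul, norm_mul (_ ^ _)]
    gcongr
  have hswap : HasSum (fun x : ℕ × ℕ => G (x.2, x.1)) (∑' x, G x) :=
    (Equiv.prodComm ℕ ℕ).hasSum_iff.2 hs.hasSum
  have h3 := hswap.prod_fiberwise (g := fun j => κ j * oddGeom u (y ^ (j + 1))) fun j => by
    refine ((hasSum_oddGeom (norm_pow_succ_mul_lt_one hy h1 j)
      (norm_pow_succ_mul_lt_one hy h2 j)).mul_left (κ j)).congr_fun fun m => ?_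
    simp only [hG]
    rw [← pow_mul, ← pow_mul, mul_comm (2 * m + 1)]
    ring
  have h4 (m : ℕ) : ∑' j, G (m, j) = (u ^ (2 * m + 1) - (u ^ (2 * m + 1))⁻¹) *
        ∑' j : ℕ, κ j * (y ^ (2 * m + 1)) ^ (j + 1) := by
    rw [← tsum_mul_left, hG]
  have h5 := hs.prod
  simp only [h4] at h5
  rw [hs.tsum_prod, tsum_congr h4] at h3
  exact ⟨h5, h3⟩

theorem tsum_mode {g : ℕ → ℂ} (hg : Summable fun n => ‖g n‖) :
    ∑' a : Mode, g a.2 = 2 * ∑' n, g n := by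
  have h := tsum_mul_tsum_of_summable_norm (f := fun _ : Bool => (1 : ℂ)) (g := g)
    Summable.of_finite hg
  simp only [tsum_fintype, Finset.sum_const, Finset.card_univ, Fintype.card_bool, one_mul] at h
  rw [← h]
  norm_num

/-- The sum over all sets of charge zero without a sign: half the trace of `q^{L₀} D(t)` on the
whole charge-zero subspace, for `q = p²`. -/
theorem hasSum_symmetric_part {p u : ℂ} (hp : ‖p‖ < 1) (h1 : ‖p * u‖ < 1) (h2 : ‖p * u⁻¹‖ < 1)
    (hu : u ≠ 0) (hu1 : u ^ 2 ≠ 1) :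
    HasSum (fun S : Finset Mode => if chargeOf S = 0 then
      (p ^ 2) ^ (degree S / 2) * (eigD u S * (1 / 2)) else 0)
      (1 / (qPoch (p ^ 2) (p ^ 2) * Theta (p ^ 2) u)) := by
  have hq := norm_sq_lt_one hp
  have hP := qPoch_self_ne_zero hq
  have huu : u - u⁻¹ ≠ 0 := by
    intro h
    apply hu1
    field_simp at h
    linear_combination h
  have hwf : Summable fun a : Mode =>
      ‖(u ^ (2 * a.2 + 1) - (u ^ (2 * a.2 + 1))⁻¹) * p ^ (2 * a.2 + 1)‖ :=
    summable_bool_prod (summable_oddWeight h1 h2) fun _ => norm_nonneg _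
  have hA := hasSum_prod_mul_sum (summable_mode_weight hp) hwf
    (h := fun S => if chargeOf S = 0 then 1 else 0) fun S => by split_ifs <;> simp
  simp only [prod_pow_eq_pow_degree] at hA
  have hZ := (summable_ite_pow_degree hp fun S => chargeOf S = 0).hasSum
  have hZ0 : chargeSum p 0 = 1 / qPoch (p ^ 2) (p ^ 2) := by simp [chargeSum_eq hp]
  rw [← chargeSum, hZ0] at hZ
  have hκ : ∃ C : ℝ, ∀ j : ℕ, ‖(-1) ^ j * (p ^ ((j + 1) ^ 2) / qPoch (p ^ 2) (p ^ 2))‖ ≤ C := by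
    refine ⟨1 / ‖qPoch (p ^ 2) (p ^ 2)‖, fun j => ?_⟩
    rw [norm_mul, norm_pow, norm_neg, norm_one, one_pow, one_mul, norm_div, norm_pow]
    gcongr
    exact pow_le_one₀ (norm_nonneg _) hp.le
  obtain ⟨C, hκ⟩ := hκ
  have hO (a : Mode) : occupiedSum p a 0 =
      ∑' j : ℕ, (-1) ^ j * (p ^ ((j + 1) ^ 2) / qPoch (p ^ 2) (p ^ 2)) *
        (p ^ (2 * a.2 + 1)) ^ (j + 1) := by
    rw [← (hasSum_occupiedSum hp a).tsum_eq]
    exact tsum_congr fun j => by ring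
  obtain ⟨hB1, hB2⟩ := tsum_oddWeight_mul_tsum hp h1 h2 hκ
  have hmode := tsum_mode hB1.norm
  have hA' : ∑' a : Mode, (u ^ (2 * a.2 + 1) - (u ^ (2 * a.2 + 1))⁻¹) * occupiedSum p a 0 =
      2 * ((qPoch (p ^ 2) (p ^ 2))⁻¹ * (u - u⁻¹)⁻¹ * (qPoch (p ^ 2) (p ^ 2) ^ 2 /
        (qPoch (p ^ 2 * u ^ 2) (p ^ 2) * qPoch (p ^ 2 * (u ^ 2)⁻¹) (p ^ 2)) - 1)) := by
    simp only [hO]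
    rw [hmode]
    congr 1
    have hne (v : ℂ) (hv : ‖p * v‖ < 1) (j : ℕ) : 1 - (p ^ 2) ^ (j + 1) * v ^ 2 ≠ 0 := by
      have := one_sub_ne_zero_of_norm_lt_one (norm_sq_lt_one (norm_pow_succ_mul_lt_one hp hv j))
      rwa [mul_pow, ← pow_mul, mul_comm (j + 1), pow_mul] at this
    have hpf := hasSum_partial_fractions hp (pow_ne_zero 2 hu) (hne u h1) fun j => by
      have := hne _ h2 j
      rwa [inv_pow] at this
    -- with `x = p^(j+1)` and `t = u²`, the weight `oddGeom u x` is `x / (u - u⁻¹)` times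
    -- the pole term
    refine hB2.unique ((hpf.mul_left ((qPoch (p ^ 2) (p ^ 2))⁻¹ * (u - u⁻¹)⁻¹)).congr_fun
      fun j => ?_)
    have e1 : (p ^ (j + 1)) ^ 2 = (p ^ 2) ^ (j + 1) := by rw [← pow_mul, ← pow_mul, mul_comm]
    have e2 : (u ^ 2 - 1) = (u - u⁻¹) * u := by field_simp
    have e3 : 1 - (u ^ 2)⁻¹ = (u - u⁻¹) * u⁻¹ := by field_simp
    have e4 : p ^ ((j + 1) * (j + 2)) = p ^ ((j + 1) ^ 2) * p ^ (j + 1) := by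
      rw [← pow_add]; congr 1; ring
    rw [oddGeom, poleTerm, e1, e2, e3, e4]
    field_simp
  have hA2 : HasSum (fun S : Finset Mode =>
      (if chargeOf S = 0 then 1 else 0) * p ^ degree S *
        ∑ a ∈ S, (u ^ (2 * a.2 + 1) - (u ^ (2 * a.2 + 1))⁻¹))
      (∑' a : Mode, (u ^ (2 * a.2 + 1) - (u ^ (2 * a.2 + 1))⁻¹) * occupiedSum p a 0) := hA
  rw [hA'] at hA2
  have hfin := (hA2.mul_left (1 / 2)).add (hZ.mul_left (u - u⁻¹)⁻¹)
  have hval : 1 / (qPoch (p ^ 2) (p ^ 2) * Theta (p ^ 2) u) =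
      1 / 2 * (2 * ((qPoch (p ^ 2) (p ^ 2))⁻¹ * (u - u⁻¹)⁻¹ * (qPoch (p ^ 2) (p ^ 2) ^ 2 /
        (qPoch (p ^ 2 * u ^ 2) (p ^ 2) * qPoch (p ^ 2 * (u ^ 2)⁻¹) (p ^ 2)) - 1))) +
      (u - u⁻¹)⁻¹ * (1 / qPoch (p ^ 2) (p ^ 2)) := by
    rw [Theta]
    simp only [mul_inv, inv_inv, div_eq_mul_inv]
    ring
  rw [hval]
  refine hfin.congr_fun fun S => ?_
  by_cases hS : chargeOf S = 0
  · obtain ⟨k, hk⟩ := even_degree_of_chargeOf_eq_zero hS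
    have e : (p ^ 2) ^ (degree S / 2) = p ^ degree S := by
      rw [← pow_mul]; congr 1; omega
    rw [if_pos hS, if_pos hS, if_pos hS, e, eigD]
    ring
  · simp [hS]

/-! ### The contribution of `τ` -/

theorem oddGeom_pow_succ_eq_neg_lambertTerm (q u : ℂ) (r : ℕ) :
    -oddGeom u (q ^ (r + 1)) = lambertTerm q u r := by
  rw [oddGeom, lambertTerm, ← pow_mul, mul_comm (r + 1), neg_sub]

/-- The Lambert series as a sum over modes; the denominators `1 - q^{2m+1}` are expanded in
geometric series. -/
theorem hasSum_lambertTerm {q u : ℂ} (hq : ‖q‖ < 1) (h1 : ‖q * u‖ < 1) (h2 : ‖q * u⁻¹‖ < 1) :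
    HasSum (lambertTerm q u) (∑' m : ℕ, (u ^ (2 * m + 1) - (u ^ (2 * m + 1))⁻¹) *
      (-q ^ (2 * m + 1) / (1 - q ^ (2 * m + 1)))) := by
  have h := (tsum_oddWeight_mul_tsum (κ := fun _ => -1) (C := 1) hq h1 h2 (by simp)).2
  simp only [neg_one_mul, oddGeom_pow_succ_eq_neg_lambertTerm] at h
  convert! h using 4 with m
  have hx : ‖q ^ (2 * m + 1)‖ < 1 := by
    rw [norm_pow]; exact pow_lt_one₀ (norm_nonneg _) hq (by omega)
  have hg := ((hasSum_geometric_of_norm_lt_one hx).mul_left (-q ^ (2 * m + 1))).tsum_eq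
  rw [div_eq_mul_inv, ← hg]
  exact tsum_congr fun j => by ring

/-- The part of the trace that involves `τ`: only the sets `univ ×ˢ A` contribute. -/
theorem hasSum_tau_part {q u ε : ℂ} (hq : ‖q‖ < 1) (h1 : ‖q * u‖ < 1) (h2 : ‖q * u⁻¹‖ < 1) :
    HasSum (fun S : Finset Mode => if chargeOf S = 0 then
      q ^ (degree S / 2) * (eigD u S * (1 / 2 * (ε * tauCoeff S))) else 0)
      (ε * qPoch q (q ^ 2) * ((∑' r : ℕ, lambertTerm q u r) + 1 / (u - u⁻¹))) := by
  let g : Finset ℕ → Finset Mode := fun A => Finset.univ ×ˢ A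
  have hg : Function.Injective g := fun A B h => by
    ext m
    have := congrArg ((true, m) ∈ ·) h
    simpa [g] using this
  have hdeg (A : Finset ℕ) : degree (g A) = 2 * ∑ m ∈ A, (2 * m + 1) := by
    rw [degree, Finset.sum_product, Fintype.sum_bool]
    ring
  have hch (A : Finset ℕ) : chargeOf (g A) = 0 := by
    rw [chargeOf, Finset.sum_product, Fintype.sum_bool]
    simp
  have heig (A : Finset ℕ) : eigD u (g A) =
      2 * (∑ m ∈ A, (u ^ (2 * m + 1) - (u ^ (2 * m + 1))⁻¹) + (u - u⁻¹)⁻¹) := by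
    rw [eigD, Finset.sum_product, Fintype.sum_bool]
    ring
  have htau (A : Finset ℕ) : tauCoeff (g A) = (-1) ^ A.card := by
    rw [tauCoeff, if_pos ((swapSet_eq_self_iff _).2 ⟨A, rfl⟩)]
    simp [g]
  let f : ℕ → ℂ := fun m => -q ^ (2 * m + 1)
  have hf : Summable fun m => ‖f m‖ := by
    simpa [f] using summable_pow_odd (norm_nonneg q) hq
  have hwf : Summable fun m : ℕ => ‖(u ^ (2 * m + 1) - (u ^ (2 * m + 1))⁻¹) * f m‖ := by
    simpa [f] using summable_oddWeight h1 h2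
  have hprod (A : Finset ℕ) :
      q ^ (degree (g A) / 2) * (-1) ^ A.card = ∏ m ∈ A, f m := by
    rw [hdeg, Nat.mul_div_cancel_left _ two_pos, ← Finset.prod_pow_eq_pow_sum,
      ← Finset.prod_const, ← Finset.prod_mul_distrib]
    exact Finset.prod_congr rfl fun m _ => by simp [f]
  have hs : Summable fun A : Finset ℕ => ∏ m ∈ A, f m := summable_finsetProd_of_summable_norm hf
  have htot : ∑' A : Finset ℕ, ∏ m ∈ A, f m = qPoch q (q ^ 2) := by
    rw [← tprod_one_add hs, qPoch]
    refine tprod_congr fun m => ?_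
    simp only [f]
    ring
  have hocc (m : ℕ) : (∑' A : Finset ℕ, if m ∈ A then 1 * ∏ i ∈ A, f i else 0) =
      -q ^ (2 * m + 1) / (1 - q ^ (2 * m + 1)) * qPoch q (q ^ 2) := by
    have hne : 1 - q ^ (2 * m + 1) ≠ 0 := one_sub_pow_succ_ne_zero hq (2 * m)
    have e := tsum_mem_eq f (fun _ => 1) m
    have hs2 : Summable fun A : Finset ℕ => if m ∈ A then 1 * ∏ i ∈ A, f i else 0 := by
      refine hs.norm.of_norm_bounded fun A => ?_
      split_ifs
      · rw [one_mul]
      · rw [norm_zero]; exact norm_nonneg _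
    have e2 : (∑' A : Finset ℕ, if m ∈ A then 0 else 1 * ∏ i ∈ A, f i) =
        qPoch q (q ^ 2) - ∑' A : Finset ℕ, if m ∈ A then 1 * ∏ i ∈ A, f i else 0 := by
      rw [← htot, ← hs.tsum_sub hs2]
      refine tsum_congr fun A => ?_
      split_ifs <;> simp
    rw [e2] at e
    have hfm : f m = -q ^ (2 * m + 1) := rfl
    rw [hfm] at e
    rw [div_mul_eq_mul_div, eq_div_iff hne]
    linear_combination e
  have hA := hasSum_prod_mul_sum (w := fun m : ℕ => u ^ (2 * m + 1) - (u ^ (2 * m + 1))⁻¹)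
    (h := fun _ => 1) hf hwf (by simp)
  simp only [hocc, ← mul_assoc] at hA
  rw [tsum_mul_right] at hA
  have hL := hasSum_lambertTerm hq h1 h2
  rw [← hL.tsum_eq] at hA
  have hall := ((hA.add ((htot ▸ hs.hasSum).mul_right (u - u⁻¹)⁻¹)).mul_left ε)
  -- `tauCoeff` vanishes off the range of `g`
  rw [← hg.hasSum_iff]
  · have e : ε * qPoch q (q ^ 2) * ((∑' r : ℕ, lambertTerm q u r) + 1 / (u - u⁻¹)) =
      ε * ((∑' r : ℕ, lambertTerm q u r) * qPoch q (q ^ 2) +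
        qPoch q (q ^ 2) * (u - u⁻¹)⁻¹) := by ring
    rw [e]
    refine hall.congr_fun fun A => ?_
    simp only [Function.comp_apply]
    rw [if_pos (hch A), heig, htau, ← hprod]
    ring
  · intro S hS
    have : tauCoeff S = 0 := if_neg fun h => hS (by
      obtain ⟨A, rfl⟩ := (swapSet_eq_self_iff S).1 h
      exact ⟨A, rfl⟩)
    simp [this]

/-! ### The logarithmic derivative of `pochRatio` -/

theorem logDeriv_qPoch {q x : ℂ} (hq : ‖q‖ < 1) (hx : ∀ r : ℕ, 1 - x * q ^ r ≠ 0) :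
    DifferentiableAt ℂ (fun x => qPoch x q) x ∧
      HasSum (fun r : ℕ => -q ^ r / (1 - x * q ^ r)) (logDeriv (fun x => qPoch x q) x) := by
  let K := Metric.ball (0 : ℂ) (‖x‖ + 1)
  have hxK : x ∈ K := by simp [K]
  have hu : Summable fun r : ℕ => (‖x‖ + 1) * ‖q‖ ^ r :=
    (summable_geometric_of_lt_one (norm_nonneg q) hq).mul_left _
  have hm := hu.multipliableLocallyUniformlyOn_nat_one_add (f := fun r z => -(z * q ^ r))
    (K := K) Metric.isOpen_ball (Eventually.of_forall fun r z hz => by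
      rw [norm_neg, norm_mul, norm_pow]
      have : ‖z‖ ≤ ‖x‖ + 1 := by simpa [K] using (Metric.mem_ball.1 hz).le
      gcongr) fun r => by fun_prop
  simp only [← sub_eq_add_neg] at hm
  have hdiff : DifferentiableAt ℂ (fun x => qPoch x q) x :=
    (hm.hasProdLocallyUniformlyOn.differentiableOn
      (.of_forall fun _ => by simpa [Finset.prod_fn] using
        DifferentiableOn.finsetProd (fun _ _ => by fun_prop)) Metric.isOpen_ball).differentiableAt
      (Metric.isOpen_ball.mem_nhds hxK)
  have hterm (r : ℕ) : logDeriv (fun z : ℂ => 1 - z * q ^ r) x = -q ^ r / (1 - x * q ^ r) := by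
    rw [logDeriv_apply]
    have : HasDerivAt (fun z : ℂ => 1 - z * q ^ r) (-(1 * q ^ r)) x :=
      ((hasDerivAt_id x).mul_const (q ^ r)).const_sub 1
    rw [this.deriv, one_mul]
  have hs : Summable fun r : ℕ => -q ^ r / (1 - x * q ^ r) := by
    have hlim : Tendsto (fun r : ℕ => (1 - x * q ^ r)⁻¹) atTop (𝓝 (1 - x * 0)⁻¹) :=
      (((tendsto_pow_atTop_nhds_zero_of_norm_lt_one hq).const_mul x).const_sub 1).inv₀ (by simp)
    obtain ⟨C, hC0, hC⟩ := exists_bound_of_tendsto hlim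
    refine ((summable_geometric_of_lt_one (norm_nonneg q) hq).mul_right C).of_norm_bounded
      fun r => ?_
    rw [div_eq_mul_inv, norm_mul, norm_neg, norm_pow]
    have := hC r
    gcongr
  refine ⟨hdiff, ?_⟩
  have h := logDeriv_tprod_eq_tsum Metric.isOpen_ball hxK hx (fun r => by fun_prop)
    (by simpa only [hterm] using hs) hm (qPoch_ne_zero hq hx)
  simp only [hterm] at h
  have h2 := hs.hasSum
  rw [← h] at h2
  exact h2

theorem logDeriv_qPoch_comp {q x h' : ℂ} {h : ℂ → ℂ} (hq : ‖q‖ < 1) (hh : HasDerivAt h h' x)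
    (hx : ∀ r : ℕ, 1 - h x * q ^ r ≠ 0) :
    DifferentiableAt ℂ (fun x => qPoch (h x) q) x ∧
      HasSum (fun r : ℕ => -q ^ r / (1 - h x * q ^ r) * h')
        (logDeriv (fun x => qPoch (h x) q) x) := by
  obtain ⟨h1, h2⟩ := logDeriv_qPoch hq hx
  have h3 := h1.hasDerivAt.comp x hh
  refine ⟨h3.differentiableAt, ?_⟩
  convert! h2.mul_right h' using 1
  rw [logDeriv_apply, logDeriv_apply]
  have h4 : deriv (fun x => qPoch (h x) q) x = _ := h3.deriv
  rw [h4]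
  ring

/-- The logarithmic derivative of `pochRatio` along a branch `s` of the square root. The factors
with opposite signs of `t^{1/2}` combine into functions of `t`, up to a factor `t^{±1/2}`, and the
factor of index `0` in `(±t^{-1/2}; q)_∞` produces the term `1 / (t^{1/2} - t^{-1/2})`. -/
theorem logDeriv_pochRatio {q t : ℂ} {s : ℂ → ℂ} (hq : ‖q‖ < 1) (h1 : ‖q * s t‖ < 1)
    (h2 : ‖q * (s t)⁻¹‖ < 1) (hu : s t ≠ 0) (hu1 : s t ^ 2 ≠ 1)
    (hs : HasDerivAt s (2 * s t)⁻¹ t) :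
    DifferentiableAt ℂ (fun x => pochRatio q (s x)) t ∧ pochRatio q (s t) ≠ 0 ∧
      s t ^ 2 * logDeriv (fun x => pochRatio q (s x)) t =
        (∑' r : ℕ, lambertTerm q (s t) r) + 1 / (s t - (s t)⁻¹) := by
  set u := s t with hut
  have hd1 : HasDerivAt (fun x => (s x)⁻¹) (-(2 * u)⁻¹ / u ^ 2) t := hs.inv hu
  have hd2 : HasDerivAt (fun x => q * s x) (q * (2 * u)⁻¹) t := hs.const_mul q
  have hd3 : HasDerivAt (fun x => -(s x)⁻¹) (-(-(2 * u)⁻¹ / u ^ 2)) t := hd1.neg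
  have hd4 : HasDerivAt (fun x => -(q * s x)) (-(q * (2 * u)⁻¹)) t := hd2.neg
  have hsq2 (r : ℕ) : 1 - u⁻¹ ^ 2 * q ^ (2 * r) ≠ 0 := by
    cases r with
    | zero =>
      intro h
      apply hu1
      field_simp at h
      linear_combination h
    | succ r =>
      have := one_sub_ne_zero_of_norm_lt_one (norm_sq_lt_one (norm_pow_succ_mul_lt_one hq h2 r))
      rwa [mul_pow, ← pow_mul, mul_comm (r + 1), mul_comm] at this
  have hsq1 (r : ℕ) : 1 - (q * u) ^ 2 * q ^ (2 * r) ≠ 0 := by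
    have := one_sub_ne_zero_of_norm_lt_one (norm_sq_lt_one (norm_pow_succ_mul_lt_one hq h1 r))
    intro h
    apply this
    rw [← h]; ring
  have hf2 (r : ℕ) : 1 - u⁻¹ ^ 2 * q ^ (2 * r) = (1 - u⁻¹ * q ^ r) * (1 - -u⁻¹ * q ^ r) := by ring
  have hf1 (r : ℕ) : 1 - (q * u) ^ 2 * q ^ (2 * r) =
      (1 - q * u * q ^ r) * (1 - -(q * u) * q ^ r) := by ring
  have hn1 (r : ℕ) : 1 - u⁻¹ * q ^ r ≠ 0 := left_ne_zero_of_mul (hf2 r ▸ hsq2 r)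
  have hn2 (r : ℕ) : 1 - -u⁻¹ * q ^ r ≠ 0 := right_ne_zero_of_mul (hf2 r ▸ hsq2 r)
  have hn3 (r : ℕ) : 1 - q * u * q ^ r ≠ 0 := left_ne_zero_of_mul (hf1 r ▸ hsq1 r)
  have hn4 (r : ℕ) : 1 - -(q * u) * q ^ r ≠ 0 := right_ne_zero_of_mul (hf1 r ▸ hsq1 r)
  obtain ⟨a1, b1⟩ := logDeriv_qPoch_comp hq hd1 hn1
  obtain ⟨a2, b2⟩ := logDeriv_qPoch_comp hq hd3 hn2
  obtain ⟨a3, b3⟩ := logDeriv_qPoch_comp hq hd2 hn3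
  obtain ⟨a4, b4⟩ := logDeriv_qPoch_comp hq hd4 hn4
  have c1 : qPoch (s t)⁻¹ q ≠ 0 := qPoch_ne_zero hq hn1
  have c2 : qPoch (-(s t)⁻¹) q ≠ 0 := qPoch_ne_zero hq hn2
  have c3 : qPoch (q * s t) q ≠ 0 := qPoch_ne_zero hq hn3
  have c4 : qPoch (-(q * s t)) q ≠ 0 := qPoch_ne_zero hq hn4
  refine ⟨(a1.mul a3).div (a2.mul a4) (mul_ne_zero c2 c4),
    div_ne_zero (mul_ne_zero c1 c3) (mul_ne_zero c2 c4), ?_⟩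
  have hlog : logDeriv (fun x => pochRatio q (s x)) t =
      logDeriv (fun x => qPoch (s x)⁻¹ q) t + logDeriv (fun x => qPoch (q * s x) q) t -
      (logDeriv (fun x => qPoch (-(s x)⁻¹) q) t + logDeriv (fun x => qPoch (-(q * s x)) q) t) := by
    rw [← logDeriv_mul t c1 c3 a1 a3, ← logDeriv_mul t c2 c4 a2 a4]
    exact logDeriv_div t (mul_ne_zero c1 c3) (mul_ne_zero c2 c4) (a1.mul a3) (a2.mul a4)
  have hA : HasSum (fun r : ℕ => q ^ r * u⁻¹ / (1 - q ^ (2 * r) * (u ^ 2)⁻¹))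
      (u ^ 2 * (logDeriv (fun x => qPoch (s x)⁻¹ q) t -
        logDeriv (fun x => qPoch (-(s x)⁻¹) q) t)) := by
    refine ((b1.sub b2).mul_left (u ^ 2)).congr_fun fun r => ?_
    have e : 1 - q ^ (2 * r) * (u ^ 2)⁻¹ = (1 - u⁻¹ * q ^ r) * (1 - -u⁻¹ * q ^ r) := by
      rw [← hf2]; ring
    have d1 := hn1 r
    have d2 := hn2 r
    have d1' : u - q ^ r ≠ 0 := fun h => d1 (by field_simp; rw [h, mul_zero])
    have d2' : u + q ^ r ≠ 0 := fun h => d2 (by field_simp; linear_combination h)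
    rw [← hut, e]
    simp only [neg_mul, sub_neg_eq_add] at d2 ⊢
    field_simp
    ring
  have hB : HasSum (fun r : ℕ => q ^ (r + 1) * u / (1 - q ^ (2 * (r + 1)) * u ^ 2))
      (-(u ^ 2 * (logDeriv (fun x => qPoch (q * s x) q) t -
        logDeriv (fun x => qPoch (-(q * s x)) q) t))) := by
    refine ((b3.sub b4).mul_left (u ^ 2)).neg.congr_fun fun r => ?_
    have e : 1 - q ^ (2 * (r + 1)) * u ^ 2 = (1 - q * u * q ^ r) * (1 - -(q * u) * q ^ r) := by
      rw [← hf1]; ring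
    have d1 := hn3 r
    have d2 := hn4 r
    rw [← hut, e, pow_succ]
    simp only [neg_mul, sub_neg_eq_add] at d2 ⊢
    generalize q ^ r = z at d1 d2 ⊢
    obtain ⟨α, hα⟩ : ∃ α, α = 1 - q * u * z := ⟨_, rfl⟩
    obtain ⟨β, hβ⟩ : ∃ β, β = 1 + q * u * z := ⟨_, rfl⟩
    rw [← hα] at d1
    rw [← hβ] at d2
    rw [← hα, ← hβ]
    field_simp
    rw [hα, hβ]
    ring
  have hA1 := (hasSum_nat_add_iff' 1).2 hA
  have hL := (hA1.sub hB).tsum_eq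
  change ∑' r : ℕ, lambertTerm q u r = _ at hL
  have e0 : 1 / (u - u⁻¹) = q ^ 0 * u⁻¹ / (1 - q ^ (2 * 0) * (u ^ 2)⁻¹) := by
    have h3 : u ^ 2 - 1 ≠ 0 := sub_ne_zero.2 hu1
    have e2 : 1 - (u ^ 2)⁻¹ = (u - u⁻¹) * u⁻¹ := by field_simp
    simp only [pow_zero, one_mul, mul_zero]
    rw [e2, mul_comm, ← div_div, div_self (inv_ne_zero hu)]
  rw [hL, e0, hlog, Finset.sum_range_one]
  ring

/-! ### The trace -/

/-- The trace formula with `u = t^{1/2}`. A square root `p` of `q` accounts for the half-integral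
energies of the single modes. -/
theorem hasQTrace_D {q u ε : ℂ} (hq : ‖q‖ < 1) (hu : u ≠ 0) (hu1 : u ^ 2 ≠ 1)
    (h1 : ‖q * u ^ 2‖ < 1) (h2 : ‖q * (u ^ 2)⁻¹‖ < 1) (hε : ε = 1 ∨ ε = -1) :
    ‖q * u‖ < 1 ∧ ‖q * u⁻¹‖ < 1 ∧ HasQTrace q (D u) (chargeZero ε)
      (1 / (qPoch q q * Theta q u) +
        ε * qPoch q (q ^ 2) * ((∑' r : ℕ, lambertTerm q u r) + 1 / (u - u⁻¹))) := by
  obtain ⟨p, rfl⟩ := IsAlgClosed.exists_pow_nat_eq q two_pos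
  have hsq {z : ℂ} (hz : ‖z ^ 2‖ < 1) : ‖z‖ < 1 := by
    rw [norm_pow] at hz
    exact (pow_lt_one_iff_of_nonneg (norm_nonneg z) two_ne_zero).1 hz
  have hp : ‖p‖ < 1 := hsq hq
  have hp1 : ‖p * u‖ < 1 := hsq (by rwa [mul_pow])
  have hp2 : ‖p * u⁻¹‖ < 1 := hsq (by rwa [mul_pow, inv_pow])
  have hq1 : ‖p ^ 2 * u‖ < 1 := norm_pow_succ_mul_lt_one hp hp1 1
  have hq2 : ‖p ^ 2 * u⁻¹‖ < 1 := norm_pow_succ_mul_lt_one hp hp2 1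
  refine ⟨hq1, hq2, hasQTrace_of_hasSum hε ?_⟩
  refine ((hasSum_symmetric_part hp hp1 hp2 hu hu1).add
    (hasSum_tau_part (ε := ε) hq hq1 hq2)).congr_fun fun S => ?_
  split_ifs
  · ring
  · rw [add_zero]

end FermionFock

/-- `s` is a branch of the square root near `t`, so that `s t = t^{1/2}`. -/
theorem mainTheorem6 (q t : ℂ) (s : ℂ → ℂ)
    (hq : ‖q‖ < 1) (hqt : ‖q‖ < ‖t‖) (hqt' : ‖q‖ * ‖t‖ < 1) (ht : t ≠ 1)
    (hs : ContinuousAt s t) (hs2 : ∀ᶠ x in 𝓝 t, s x ^ 2 = x)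
    (ε : ℂ) (hε : ε = 1 ∨ ε = -1) :
    (Summable (FermionFock.lambertTerm q (s t)) ∧
      FermionFock.HasQTrace q (FermionFock.D (s t)) (FermionFock.chargeZero ε)
        (1 / (FermionFock.qPoch q q * FermionFock.Theta q (s t)) +
          ε * FermionFock.qPoch q (q ^ 2) *
            ((∑' r : ℕ, FermionFock.lambertTerm q (s t) r) + 1 / (s t - (s t)⁻¹)))) ∧
    (DifferentiableAt ℂ (fun x => FermionFock.pochRatio q (s x)) t ∧
      FermionFock.pochRatio q (s t) ≠ 0 ∧
      FermionFock.HasQTrace q (FermionFock.D (s t)) (FermionFock.chargeZero ε)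
        (1 / (FermionFock.qPoch q q * FermionFock.Theta q (s t)) +
          ε * FermionFock.qPoch q (q ^ 2) *
            (t * logDeriv (fun x => FermionFock.pochRatio q (s x)) t))) := by
  have hst : s t ^ 2 = t := hs2.self_of_nhds
  have ht0 : t ≠ 0 := norm_pos_iff.1 ((norm_nonneg q).trans_lt hqt)
  have hu : s t ≠ 0 := fun h => ht0 (by rw [← hst, h]; simp)
  have hu1 : s t ^ 2 ≠ 1 := hst.symm ▸ ht
  have hd : HasDerivAt s (2 * s t)⁻¹ t := by
    refine HasDerivAt.of_local_left_inverse (f := fun z => z ^ 2) hs ?_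
      (mul_ne_zero two_ne_zero hu) hs2
    simpa using hasDerivAt_pow 2 (s t)
  have hn1 : ‖q * s t ^ 2‖ < 1 := by rwa [hst, norm_mul]
  have hn2 : ‖q * (s t ^ 2)⁻¹‖ < 1 := by
    rw [hst, norm_mul, norm_inv, ← div_eq_mul_inv]
    exact (div_lt_one (norm_pos_iff.2 ht0)).2 hqt
  obtain ⟨h1, h2, h⟩ := FermionFock.hasQTrace_D hq hu hu1 hn1 hn2 hε
  obtain ⟨h3, h4, h5⟩ := FermionFock.logDeriv_pochRatio hq h1 h2 hu hu1 hd
  rw [hst] at h5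
  rw [h5]
  exact ⟨⟨(FermionFock.hasSum_lambertTerm hq h1 h2).summable, h⟩, h3, h4, h⟩
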